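/- All manifolds, maps and forms are smooth. A Pfaffian system $I$ of constant rank on $M$ is a constant rank subbundle of $T^*M$; $\mathrm{ann}(I)\subset TM$ is its annihilator, $I^\infty_x=\{dF_x : F \text{ a smooth function near } x \text{ with } dF\in I\}$, and $I'_x=\mathrm{span}\{\theta_x : \theta \text{ a local section of } I,\ d\theta\equiv 0 \bmod I\}$. An integral curve of $I$ is an immersion $\gamma:(a,b)\to M$ with $\gamma^*I=0$ (the open interval may be unbounded). The system $I$ is *hyperbolic of class $s\ge 2$*, with singular systems $\hat V,\check V$, if about each point there is a coframe $\theta^1,\dots,\theta^s,\hat\omega,\hat\pi,\check\omega,\check\pi$ with $I=\mathrm{span}\{\theta^i\}$, $\hat V=\mathrm{span}\{\theta^i,\hat\omega,\hat\pi\}$, $\check V=\mathrm{span}\{\theta^i,\check\omega,\check\pi\}$ and, modulo $I$, $d\theta^i\equiv 0$ for $i\le s-2$, $d\theta^{s-1}\equiv\hat\omega\wedge\hat\pi$, $d\theta^s\equiv\check\omega\wedge\check\pi$. It is *Darboux integrable* if $I^\infty=0$, $\hat V+\check V^\infty=T^*M$ and $\hat V^\infty+\check V=T^*M$. An integral curve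 $\gamma$ of a hyperbolic system is *non-characteristic* if $\dot\gamma(t)\notin\mathrm{ann}(\hat V)$ and $\dot\gamma(t)\notin\mathrm{ann}(\check V)$ for all $t$. A *canonical quotient representation* $(K_1+K_2)/G_{\rm diag}$ of $I$ consists of constant rank Pfaffian systems $K_i$ of codimension $2$ on manifolds $M_i$ ($i=1,2$) with $K_i^\infty=0$, and a Lie group $G$ acting (possibly only locally) on $M_1$ and $M_2$, such that: on each $M_i$ the action is free, is regular (the quotient map $q_i:M_i\to M_i/G$ is a smooth submersion), preserves $K_i$, and is transverse to $K_i$, i.e. $\ker q_{i*}\cap\mathrm{ann}(K_i)=0$; the diagonal action on $M_1\times M_2$ is regular, with quotient map $q$, and transverse to $K_1'+K_2'$, i.e. $\ker q_*\cap\mathrm{ann}(K_1'+K_2')=0$; the orbit space $(M_1\times M_2)/G_{\rm diag}$ is $M$, or an open subset $U$ of $M$; and on it $I=(K_1+K_2)/G_{\rm diag}$, i.e. $I$ consists of the covectors $\bar\theta$ with $q^*\bar\theta\in K_1+K_2$. Here $K_1+K_2=\pi_1^*K_1+\pi_2^*K_2$, with $\pi_i:M_1\times M_2\to M_i$ the projections,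 and similarly for $K_1'+K_2'$. **Lemma.** Let $I$ be a Darboux integrable hyperbolic Pfaffian system on $M$ with canonical quotient representation $(K_1+K_2)/G_{\rm diag}$. Let $\gamma:(a,b)\to M$ be a non-characteristic integral curve of $I$ and let $\sigma:(a,b)\to M_1\times M_2$ be an integral curve of $K_1+K_2$ with $q\circ\sigma=\gamma$. Then $K_1+K_2$ is a hyperbolic Pfaffian system, and $\sigma$ is a non-characteristic integral curve of it. -/

import Mathlib

open Set
open scoped Manifold ContDiff

noncomputable section

namespace Pfaff

section Basic

variable {E H : Type*} [NormedAddCommGroup E] [NormedSpace ℝ E] [TopologicalSpace H]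
  (J : ModelWithCorners ℝ E H) {M : Type*} [TopologicalSpace M] [ChartedSpace H M]

/-- The cotangent space of `M` at `x`. -/
abbrev Cotangent (x : M) : Type _ := TangentSpace J x →L[ℝ] ℝ

variable (M) in
/-- (Not necessarily smooth) 1-forms on `M`. -/
abbrev OneForm : Type _ := ∀ x : M, Cotangent J x

variable (M) in
/-- A family of subspaces of the cotangent spaces of `M`, one at each point. -/
abbrev CotangentFamily : Type _ := ∀ x : M, Submodule ℝ (Cotangent J x)

variable {J}

/-- The 1-form `θ` is smooth on `U`, as a section of the cotangent bundle. -/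
def OneForm.SmoothOn [IsManifold J ∞ M] (θ : OneForm J M) (U : Set M) : Prop :=
  ContMDiffOn J (J.prod 𝓘(ℝ, E →L[ℝ] ℝ)) ∞
    (fun x ↦ Bundle.TotalSpace.mk' (E →L[ℝ] ℝ)
      (E := fun x : M ↦ TangentSpace J x →L[ℝ] Bundle.Trivial M ℝ x) x (θ x)) U

/-- The expression of the 1-form `θ` in the preferred chart at `x`: the pullback of `θ` under the
inverse of that chart. -/
def OneForm.inChart (θ : OneForm J M) (x : M) (u : E) : E →L[ℝ] ℝ :=
  (θ ((extChartAt J x).symm u)).comp (mfderiv 𝓘(ℝ, E) J (extChartAt J x).symm u)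

/-- The exterior derivative `(dθ)_x(v, w)` of a 1-form on a manifold without boundary, computed in
the preferred chart at `x`. -/
def OneForm.d (θ : OneForm J M) (x : M) (v w : TangentSpace J x) : ℝ :=
  extDeriv (fun u ↦ ContinuousAlternatingMap.ofSubsingleton ℝ E ℝ (0 : Fin 1) (θ.inChart x u))
    (extChartAt J x x)
    ![mfderiv J 𝓘(ℝ, E) (extChartAt J x) x v, mfderiv J 𝓘(ℝ, E) (extChartAt J x) x w]

/-- The value `(α ∧ β)(v, w)` of the wedge product of two covectors. -/
def wedge {x : M} (α β : Cotangent J x) (v w : TangentSpace J x) : ℝ := α v * β w - α w * β v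

/-- The annihilator in `T_x M` of a subspace of `T*_x M`. -/
def ann {x : M} (S : Submodule ℝ (Cotangent J x)) : Submodule ℝ (TangentSpace J x) where
  carrier := {v | ∀ α ∈ S, α v = 0}
  add_mem' := fun {v w} hv hw α hα ↦ by rw [map_add, hv α hα, hw α hα, add_zero]
  zero_mem' := fun α _ ↦ map_zero α
  smul_mem' := fun c v hv α hα ↦ by rw [map_smul, hv α hα, smul_zero]

/-- Congruence `Φ ≡ Ψ mod I` of 2-forms at the point `x`. The difference lies in the algebraic
ideal generated by the subspace `I x` exactly when it vanishes on the annihilator of `I x`. -/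
def CongrMod (I : CotangentFamily J M) (x : M) (Φ Ψ : TangentSpace J x → TangentSpace J x → ℝ) :
    Prop :=
  ∀ v ∈ ann (I x), ∀ w ∈ ann (I x), Φ v w = Ψ v w

/-- `I` is a Pfaffian system of constant rank `r`: a smooth rank `r` subbundle of `T*M`. -/
def IsPfaffianSystem [IsManifold J ∞ M] (r : ℕ) (I : CotangentFamily J M) : Prop :=
  ∀ x : M, ∃ U : Set M, IsOpen U ∧ x ∈ U ∧ ∃ θ : Fin r → OneForm J M,
    (∀ i, (θ i).SmoothOn U) ∧
    ∀ y ∈ U, LinearIndependent ℝ (fun i ↦ θ i y) ∧ I y = Submodule.span ℝ (range fun i ↦ θ i y)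

/-- The space `I^∞_x` of differentials at `x` of local first integrals of `I` defined about `x`.
(These differentials already form a subspace.) -/
def firstIntegrals (I : CotangentFamily J M) : CotangentFamily J M := fun x ↦
  Submodule.span ℝ {α | ∃ (F : M → ℝ) (U : Set M), IsOpen U ∧ x ∈ U ∧
    ContMDiffOn J 𝓘(ℝ, ℝ) ∞ F U ∧ (∀ y ∈ U, mfderiv J 𝓘(ℝ, ℝ) F y ∈ I y) ∧
    α = mfderiv J 𝓘(ℝ, ℝ) F x}

/-- The derived system `I'`: the values of local sections `θ` of `I` with `dθ ≡ 0 mod I`. -/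
def derivedSystem [IsManifold J ∞ M] (I : CotangentFamily J M) : CotangentFamily J M := fun x ↦
  Submodule.span ℝ {α | ∃ (θ : OneForm J M) (U : Set M), IsOpen U ∧ x ∈ U ∧ θ.SmoothOn U ∧
    (∀ y ∈ U, θ y ∈ I y ∧ CongrMod I y (θ.d y) 0) ∧ α = θ x}

/-- `I` is a hyperbolic Pfaffian system of class `s` with singular (characteristic) systems `V`
and `W`. About each point there is a coframe `θ 0, …, θ (s-1), η 0, η 1, η 2, η 3` with
`I = span {θ i}`, `V = span {θ i, η 0, η 1}`, `W = span {θ i, η 2, η 3}` and, modulo `I`,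
`dθ i ≡ 0` for all but the last two indices, `dθ (s-2) ≡ η 0 ∧ η 1`, `dθ (s-1) ≡ η 2 ∧ η 3`. -/
def IsHyperbolic [IsManifold J ∞ M] (s : ℕ) (I V W : CotangentFamily J M) : Prop :=
  2 ≤ s ∧ ∀ x : M, ∃ U : Set M, IsOpen U ∧ x ∈ U ∧
    ∃ (θ : Fin s → OneForm J M) (η : Fin 4 → OneForm J M),
      (∀ i, (θ i).SmoothOn U) ∧ (∀ k, (η k).SmoothOn U) ∧
      ∀ y ∈ U,
        LinearIndependent ℝ (Sum.elim (fun i ↦ θ i y) (fun k ↦ η k y)) ∧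
        Submodule.span ℝ (range (Sum.elim (fun i ↦ θ i y) (fun k ↦ η k y))) = ⊤ ∧
        I y = Submodule.span ℝ (range fun i ↦ θ i y) ∧
        V y = Submodule.span ℝ ((range fun i ↦ θ i y) ∪ {η 0 y, η 1 y}) ∧
        W y = Submodule.span ℝ ((range fun i ↦ θ i y) ∪ {η 2 y, η 3 y}) ∧
        (∀ i : Fin s, (i : ℕ) + 2 < s → CongrMod I y ((θ i).d y) 0) ∧
        (∀ i : Fin s, (i : ℕ) + 2 = s → CongrMod I y ((θ i).d y) (wedge (η 0 y) (η 1 y))) ∧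
        (∀ i : Fin s, (i : ℕ) + 1 = s → CongrMod I y ((θ i).d y) (wedge (η 2 y) (η 3 y)))

/-- Darboux integrability of a hyperbolic system `I` with singular systems `V` and `W`. -/
def IsDarbouxIntegrable (I V W : CotangentFamily J M) : Prop :=
  (∀ x, firstIntegrals I x = ⊥) ∧
  (∀ x, V x ⊔ firstIntegrals W x = ⊤) ∧
  (∀ x, firstIntegrals V x ⊔ W x = ⊤)

variable (J) in
/-- The velocity vector of a curve. -/
def velocity (γ : ℝ → M) (t : ℝ) : TangentSpace J (γ t) := mfderiv 𝓘(ℝ, ℝ) J γ t (1 : ℝ)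

/-- `γ` restricted to the open interval `T` is an integral curve of `I`: a smooth immersion whose
velocities are annihilated by `I`. -/
def IsIntegralCurveOf (I : CotangentFamily J M) (γ : ℝ → M) (T : Set ℝ) : Prop :=
  ContMDiffOn 𝓘(ℝ, ℝ) J ∞ γ T ∧
    ∀ t ∈ T, velocity J γ t ≠ 0 ∧ velocity J γ t ∈ ann (I (γ t))

/-- `γ` restricted to the open interval `T` is a non-characteristic integral curve of the
hyperbolic system `I` with singular systems `V` and `W`. -/
def IsNonCharacteristicCurve (I V W : CotangentFamily J M) (γ : ℝ → M) (T : Set ℝ) : Prop :=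
  IsIntegralCurveOf I γ T ∧
    ∀ t ∈ T, velocity J γ t ∉ ann (V (γ t)) ∧ velocity J γ t ∉ ann (W (γ t))

end Basic

section Maps

variable {E H M E' H' M' : Type*}
  [NormedAddCommGroup E] [NormedSpace ℝ E] [TopologicalSpace H]
  [TopologicalSpace M] [ChartedSpace H M]
  [NormedAddCommGroup E'] [NormedSpace ℝ E'] [TopologicalSpace H']
  [TopologicalSpace M'] [ChartedSpace H' M']

/-- The pullback `f^* : T*_{f x} M' → T*_x M`. -/
def pullback (J : ModelWithCorners ℝ E H) (J' : ModelWithCorners ℝ E' H') (f : M → M') (x : M) :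
    Cotangent J' (f x) →ₗ[ℝ] Cotangent J x where
  toFun α := α.comp (mfderiv J J' f x)
  map_add' α β := ContinuousLinearMap.add_comp α β _
  map_smul' c α := ContinuousLinearMap.smul_comp c α _

variable {J : ModelWithCorners ℝ E H} {J' : ModelWithCorners ℝ E' H'}

/-- The reduction of `K` by a quotient map `q`: at `y`, the covectors whose pullback lies in `K` at
every point of the fibre over `y`. -/
def reduction (q : M → M') (K : CotangentFamily J M) : CotangentFamily J' M' := fun y ↦
  { carrier := {α | ∀ (p : M) (h : q p = y), pullback J J' q p (h.symm ▸ α) ∈ K p}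
    add_mem' := by
      intro α β hα hβ p h
      subst h
      simpa using (K p).add_mem (hα p rfl) (hβ p rfl)
    zero_mem' := by
      intro p h
      subst h
      simp
    smul_mem' := by
      intro c α hα p h
      subst h
      simpa using (K p).smul_mem c (hα p rfl) }

/-- The sum `K₁ + K₂ = π₁^* K₁ + π₂^* K₂` on `M × M'`. -/
def sumSystem (K₁ : CotangentFamily J M) (K₂ : CotangentFamily J' M') :
    CotangentFamily (J.prod J') (M × M') := fun p ↦
  (K₁ p.1).map (pullback (J.prod J') J (Prod.fst : M × M' → M) p) ⊔
    (K₂ p.2).map (pullback (J.prod J') J' (Prod.snd : M × M' → M') p)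

/-- The foliation by the fibres of `q` is transverse to `K`: `ker q_* ∩ ann K = 0`. -/
def IsTransverse (J' : ModelWithCorners ℝ E' H') (q : M → M') (K : CotangentFamily J M) : Prop :=
  ∀ p : M, ∀ v : TangentSpace J p, mfderiv J J' q p v = 0 → v ∈ ann (K p) → v = 0

end Maps

section Actions

variable {EG HG E H E' H' : Type*}
  [NormedAddCommGroup EG] [NormedSpace ℝ EG] [TopologicalSpace HG]
  [NormedAddCommGroup E] [NormedSpace ℝ E] [TopologicalSpace H]
  [NormedAddCommGroup E'] [NormedSpace ℝ E'] [TopologicalSpace H']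
  (JG : ModelWithCorners ℝ EG HG) (J : ModelWithCorners ℝ E H)
  (G : Type*) [TopologicalSpace G] [ChartedSpace HG G] [Group G]
  (M : Type*) [TopologicalSpace M] [ChartedSpace H M]
  {M' : Type*} [TopologicalSpace M'] [ChartedSpace H' M']

/-- A (smooth) local action of the Lie group `G` on the manifold `M`. An action in the usual sense
is one with `dom = univ`. The values of `act` outside `dom` carry no information. -/
structure LocalAction where
  /-- The pairs `(g, x)` for which `g • x` is defined. -/
  dom : Set (G × M)
  /-- The action map. -/
  act : G → M → M
  isOpen_dom : IsOpen dom
  contMDiffOn_act : ContMDiffOn (JG.prod J) J ∞ (fun p : G × M ↦ act p.1 p.2) dom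
  one_mem : ∀ x, (1, x) ∈ dom
  one_act : ∀ x, act 1 x = x
  mul_act : ∀ g h x, (h, x) ∈ dom → (g, act h x) ∈ dom → (g * h, x) ∈ dom →
    act (g * h) x = act g (act h x)
  inv_mem : ∀ g x, (g, x) ∈ dom → (g⁻¹, act g x) ∈ dom

namespace LocalAction

variable {JG J G M} {J' : ModelWithCorners ℝ E' H'}

/-- The orbits: the equivalence relation generated by `x ∼ g • x`. -/
def SameOrbit (a : LocalAction JG J G M) : M → M → Prop :=
  Relation.EqvGen fun x y ↦ ∃ g, (g, x) ∈ a.dom ∧ y = a.act g x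

/-- The action is free. -/
def IsFree (a : LocalAction JG J G M) : Prop :=
  ∀ g x, (g, x) ∈ a.dom → a.act g x = x → g = 1

/-- `G` is a symmetry group of `K`: `g^* K = K`. -/
def IsSymmetry (a : LocalAction JG J G M) (K : CotangentFamily J M) : Prop :=
  ∀ g x, (g, x) ∈ a.dom → (K (a.act g x)).map (pullback J J (a.act g) x) = K x

/-- The action is regular with quotient map `q`: `q` is a smooth submersion whose non-empty fibres
are the orbits, so it identifies `M / G` with the open subset `range q` of `M'`. -/
structure IsRegularQuotient (a : LocalAction JG J G M) (J' : ModelWithCorners ℝ E' H')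
    (q : M → M') : Prop where
  contMDiff : ContMDiff J J' ∞ q
  submersion : ∀ x, Function.Surjective (mfderiv J J' q x)
  fibre : ∀ x y, q x = q y ↔ a.SameOrbit x y

/-- The diagonal local action of `G` on `M × M'`. -/
def diag (a : LocalAction JG J G M) (a' : LocalAction JG J' G M') :
    LocalAction JG (J.prod J') G (M × M') where
  dom := {p | (p.1, p.2.1) ∈ a.dom ∧ (p.1, p.2.2) ∈ a'.dom}
  act g p := (a.act g p.1, a'.act g p.2)
  isOpen_dom :=
    (a.isOpen_dom.preimage (by fun_prop : Continuous fun p : G × M × M' ↦ (p.1, p.2.1))).inter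
      (a'.isOpen_dom.preimage (by fun_prop : Continuous fun p : G × M × M' ↦ (p.1, p.2.2)))
  contMDiffOn_act := by
    refine ContMDiffOn.prodMk ?_ ?_
    · exact a.contMDiffOn_act.comp (t := a.dom)
        (f := fun p : G × M × M' ↦ (p.1, p.2.1))
        (contMDiff_fst.prodMk (contMDiff_fst.comp contMDiff_snd)).contMDiffOn
        (fun p hp ↦ hp.1)
    · exact a'.contMDiffOn_act.comp (t := a'.dom)
        (f := fun p : G × M × M' ↦ (p.1, p.2.2))
        (contMDiff_fst.prodMk (contMDiff_snd.comp contMDiff_snd)).contMDiffOn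
        (fun p hp ↦ hp.2)
  one_mem p := ⟨a.one_mem p.1, a'.one_mem p.2⟩
  one_act p := by rw [a.one_act, a'.one_act]
  mul_act g h p h₁ h₂ h₃ := by
    rw [a.mul_act g h p.1 h₁.1 h₂.1 h₃.1, a'.mul_act g h p.2 h₁.2 h₂.2 h₃.2]
  inv_mem g p hp := ⟨a.inv_mem g p.1 hp.1, a'.inv_mem g p.2 hp.2⟩

end LocalAction

end Actions

section Representation

variable {EG G E M E₁ M₁ E₂ M₂ F₁ Q₁ F₂ Q₂ : Type*}
  [NormedAddCommGroup EG] [NormedSpace ℝ EG] [TopologicalSpace G] [ChartedSpace EG G] [Group G]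
  [NormedAddCommGroup E] [NormedSpace ℝ E] [TopologicalSpace M] [ChartedSpace E M]
  [NormedAddCommGroup E₁] [NormedSpace ℝ E₁] [TopologicalSpace M₁] [ChartedSpace E₁ M₁]
  [IsManifold 𝓘(ℝ, E₁) ∞ M₁]
  [NormedAddCommGroup E₂] [NormedSpace ℝ E₂] [TopologicalSpace M₂] [ChartedSpace E₂ M₂]
  [IsManifold 𝓘(ℝ, E₂) ∞ M₂]
  [NormedAddCommGroup F₁] [NormedSpace ℝ F₁] [TopologicalSpace Q₁] [ChartedSpace F₁ Q₁]
  [NormedAddCommGroup F₂] [NormedSpace ℝ F₂] [TopologicalSpace Q₂] [ChartedSpace F₂ Q₂]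

variable (F₁ F₂) in
/-- `(K₁ + K₂) / G_diag` is a canonical quotient representation of `I`, with quotient maps
`q₁ : M₁ → M₁ / G`, `q₂ : M₂ → M₂ / G` and `q : M₁ × M₂ → (M₁ × M₂) / G_diag ⊆ M`. The
representation is global if `q` is onto, and otherwise one of the restriction of `I` to the open
set `range q`. -/
structure IsCanonicalQuotientRep
    (I : CotangentFamily 𝓘(ℝ, E) M)
    (K₁ : CotangentFamily 𝓘(ℝ, E₁) M₁) (K₂ : CotangentFamily 𝓘(ℝ, E₂) M₂)
    (a₁ : LocalAction 𝓘(ℝ, EG) 𝓘(ℝ, E₁) G M₁) (a₂ : LocalAction 𝓘(ℝ, EG) 𝓘(ℝ, E₂) G M₂)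
    (q₁ : M₁ → Q₁) (q₂ : M₂ → Q₂) (q : M₁ × M₂ → M) : Prop where
  /-- `K₁` and `K₂` have constant rank and codimension two. -/
  pfaffian₁ : ∃ r, IsPfaffianSystem r K₁ ∧ Module.finrank ℝ E₁ = r + 2
  pfaffian₂ : ∃ r, IsPfaffianSystem r K₂ ∧ Module.finrank ℝ E₂ = r + 2
  firstIntegrals₁ : ∀ x, firstIntegrals K₁ x = ⊥
  firstIntegrals₂ : ∀ x, firstIntegrals K₂ x = ⊥
  free₁ : a₁.IsFree
  free₂ : a₂.IsFree
  regular₁ : a₁.IsRegularQuotient 𝓘(ℝ, F₁) q₁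
  regular₂ : a₂.IsRegularQuotient 𝓘(ℝ, F₂) q₂
  symmetry₁ : a₁.IsSymmetry K₁
  symmetry₂ : a₂.IsSymmetry K₂
  transverse₁ : IsTransverse 𝓘(ℝ, F₁) q₁ K₁
  transverse₂ : IsTransverse 𝓘(ℝ, F₂) q₂ K₂
  /-- The diagonal action is regular, and `M` (or an open set in it) is its orbit space. -/
  regular_diag : (a₁.diag a₂).IsRegularQuotient 𝓘(ℝ, E) q
  transverse_diag : IsTransverse 𝓘(ℝ, E) q (sumSystem (derivedSystem K₁) (derivedSystem K₂))
  /-- `I = (K₁ + K₂) / G_diag`. -/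
  reduction_eq : ∀ y ∈ range q, I y = reduction q (sumSystem K₁ K₂) y

end Representation

end Pfaff

end

/-! Write `K = K₁ + K₂`. Since `K'` is contained in `K` for every system, transversality to the sum
of the derived systems implies transversality to `K`, so `q_*` is injective on `ann K`. It maps `ann
K` into `ann I`, because covectors of `I` pull back into `K`. Both annihilators have rank four, so
`q_*` is an isomorphism between them. This is the content of `exists_structure_forms_of_reduction`,
together with its consequence for 2-forms: if `Θ` is a section of `I`, then `q^*Θ` is a section of
`K`. Hence `q^*dΘ` is, modulo `K`, a combination of the structure forms `dθ i` of `K`. In particular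
the two decomposable forms `Ω₁ = η 0 ∧ η 1` and `Ω₂ = η 2 ∧ η 3` of `I` pull back to two independent
such combinations.

Hyperbolicity: `ann K` is the sum of the planes `ann K₁` and `ann K₂`, and each plane carries only a
line of 2-forms. If all structure forms of one factor vanished at a point, those of `K` would be
multiples of a single form there, which `not_d_eq_mul_of_reduction` excludes. So each factor has a
non-zero structure form at every point. A codimension-two system with this property has a coframe
with exactly one structure equation (`exists_normal_form`), and two such coframes add up to a
hyperbolic one (`isHyperbolic_sumSystem`).

Non-characteristic lift (`mem_ann_of_reduction`): let `A`, `B` be any singular systems of `K`, with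
decomposable forms `ζ₁`, `ζ₂`. On `ann K` the pair `q^*Ω₁`, `q^*Ω₂` is an invertible linear
combination of `ζ₁`, `ζ₂`. A vector `v` in `ann A` contracts `ζ₁` to zero, hence contracts some
non-trivial `m Ω₁ + n Ω₂` to zero after projection. As `Ω₁` and `Ω₂` involve complementary
covectors, `q_* v` lies in `ann V` if `m ≠ 0` and in `ann W` if `n ≠ 0`. So a characteristic
velocity upstairs projects to a characteristic velocity of `γ`; it is never necessary to decide
which of `A`, `B` corresponds to `V`. -/

noncomputable section

namespace Pfaff

open Filter Topology

/-! ### Covectors, coframes and exterior derivatives on a vector space -/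

section VectorSpace

variable {E : Type*} [NormedAddCommGroup E] [NormedSpace ℝ E]

/-- The exterior derivative `dg_u(v, w)` of a 1-form on a vector space. -/
def dForm (g : E → E →L[ℝ] ℝ) (u v w : E) : ℝ := fderiv ℝ g u v w - fderiv ℝ g u w v

/-- The alternating sum over omitted arguments has just two terms in degree one. This replaces the
general exterior derivative by `dForm`, in which all computations are made. -/
theorem extDeriv_ofSubsingleton_apply (g : E → E →L[ℝ] ℝ) (u v w : E)
    (hg : DifferentiableAt ℝ g u) :
    extDeriv (fun u ↦ ContinuousAlternatingMap.ofSubsingleton ℝ E ℝ (0 : Fin 1) (g u)) u ![v, w] =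
      dForm g u v w := by
  have h : DifferentiableAt ℝ
      (fun u ↦ ContinuousAlternatingMap.ofSubsingleton ℝ E ℝ (0 : Fin 1) (g u)) u :=
    ((ContinuousAlternatingMap.ofSubsingletonLIE (𝕜 := ℝ) (E := E) (F := ℝ)
      (0 : Fin 1)).toContinuousLinearEquiv.toContinuousLinearMap.differentiableAt).comp u hg
  refine (extDeriv_apply h _).trans ((Fin.sum_univ_two _).trans ?_)
  simp only [ContinuousAlternatingMap.ofSubsingleton_apply_apply]
  have h0 : (0 : Fin 2).removeNth ![v, w] 0 = w := rfl
  have h1 : (1 : Fin 2).removeNth ![v, w] 0 = v := rfl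
  simp only [h0, h1]
  have e : ∀ x y : E, fderiv ℝ (fun z ↦ g z x) u y = fderiv ℝ g u y x := fun x y ↦ by
    rw [fderiv_clm_apply hg (differentiableAt_const x)]
    simp
  simp [e, dForm, sub_eq_add_neg]

theorem dForm_congr {g h : E → E →L[ℝ] ℝ} {u : E} (e : g =ᶠ[𝓝 u] h) (v w : E) :
    dForm g u v w = dForm h u v w := by
  rw [dForm, dForm, e.fderiv_eq]

theorem contDiffAt_dForm {g : E → E →L[ℝ] ℝ} {e f : E → E} {u : E}
    (hg : ContDiffAt ℝ ∞ g u) (he : ContDiffAt ℝ ∞ e u) (hf : ContDiffAt ℝ ∞ f u) :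
    ContDiffAt ℝ ∞ (fun u ↦ dForm g u (e u) (f u)) u := by
  have h : ContDiffAt ℝ ∞ (fderiv ℝ g) u := hg.fderiv_right (by simp)
  exact ((h.clm_apply he).clm_apply hf).sub ((h.clm_apply hf).clm_apply he)

/-- Naturality of the exterior derivative. -/
theorem dForm_comp {E' : Type*} [NormedAddCommGroup E'] [NormedSpace ℝ E']
    {g : E' → E' →L[ℝ] ℝ} {F : E → E'} {u : E}
    (hg : DifferentiableAt ℝ g (F u)) (hF : ContDiffAt ℝ 2 F u) (v w : E) :
    dForm (fun u ↦ (g (F u)).comp (fderiv ℝ F u)) u v w =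
      dForm g (F u) (fderiv ℝ F u v) (fderiv ℝ F u w) := by
  have hF1 : DifferentiableAt ℝ F u := hF.differentiableAt (by norm_num)
  have hF2 : DifferentiableAt ℝ (fderiv ℝ F) u :=
    (hF.fderiv_right (m := 1) (by norm_num)).differentiableAt (by norm_num)
  -- The terms containing the second derivative of `F` cancel by its symmetry.
  have hs : IsSymmSndFDerivAt ℝ F u := hF.isSymmSndFDerivAt (by simp)
  have hgF : HasFDerivAt (fun u ↦ g (F u)) ((fderiv ℝ g (F u)).comp (fderiv ℝ F u)) u :=
    hg.hasFDerivAt.comp u hF1.hasFDerivAt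
  have := (hgF.clm_comp hF2.hasFDerivAt).fderiv
  simp only [dForm, this]
  simp [hs.eq v w]

theorem finrank_clm_dual [FiniteDimensional ℝ E] :
    Module.finrank ℝ (E →L[ℝ] ℝ) = Module.finrank ℝ E := by
  rw [← Subspace.dual_finrank_eq (K := ℝ) (V := E)]
  exact (LinearMap.toContinuousLinearMap (𝕜 := ℝ) (E := E) (F' := ℝ)).symm.finrank_eq

theorem clm_apply_eq_zero_of_mem_span {S : Set (E →L[ℝ] ℝ)} {α : E →L[ℝ] ℝ}
    (hα : α ∈ Submodule.span ℝ S) {v : E} (hv : ∀ β ∈ S, β v = 0) : α v = 0 := by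
  induction hα using Submodule.span_induction with
  | mem x hx => exact hv x hx
  | zero => rfl
  | add x y _ _ hx hy => rw [_root_.add_apply, hx, hy, add_zero]
  | smul c x _ hx => rw [_root_.smul_apply, hx, smul_zero]

theorem exists_complement_basis {V : Type*} [AddCommGroup V] [Module ℝ V] [FiniteDimensional ℝ V]
    {ι : Type*} [Fintype ι] {m : ℕ} {g : ι → V} (hli : LinearIndependent ℝ g)
    (hdim : Module.finrank ℝ V = Fintype.card ι + m) :
    ∃ c : Fin m → V, LinearIndependent ℝ (Sum.elim g c) ∧
      Submodule.span ℝ (range (Sum.elim g c)) = ⊤ := by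
  obtain ⟨T, hT⟩ := Submodule.exists_isCompl (Submodule.span ℝ (range g))
  have hfr : Module.finrank ℝ T = m := by
    have h1 := Submodule.finrank_add_eq_of_isCompl hT
    rw [finrank_span_eq_card hli, hdim] at h1
    omega
  let b := Module.finBasisOfFinrankEq ℝ T hfr
  have hb : Submodule.span ℝ (range fun k ↦ (b k : V)) = T := by
    have := congrArg (Submodule.map T.subtype) b.span_eq
    rw [Submodule.map_span, ← range_comp] at this
    simpa using! this
  refine ⟨fun k ↦ b k, ?_, ?_⟩
  · refine hli.sum_type ?_ ?_
    · exact b.linearIndependent.map' T.subtype (Submodule.ker_subtype T)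
    · rw [hb]; exact hT.disjoint
  · rw [Sum.elim_range, Submodule.span_union, hb]
    exact hT.sup_eq_top

/-- Continuous functionals separate points, and each of them is a combination of the `g k`. -/
theorem clm_span_separates {κ : Type*} {g : κ → E →L[ℝ] ℝ}
    (hsp : Submodule.span ℝ (range g) = ⊤) {v : E} (hv : ∀ k, g k v = 0) : v = 0 := by
  by_contra h
  obtain ⟨α, hα⟩ := SeparatingDual.exists_ne_zero (R := ℝ) h
  refine hα ?_
  exact clm_apply_eq_zero_of_mem_span (hsp ▸ Submodule.mem_top : α ∈ Submodule.span ℝ (range g))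
    (forall_mem_range.2 hv)

theorem finrank_eq_card_of_coframe [FiniteDimensional ℝ E] {κ : Type*} [Fintype κ]
    {g : κ → E →L[ℝ] ℝ} (hli : LinearIndependent ℝ g)
    (hsp : Submodule.span ℝ (range g) = ⊤) : Module.finrank ℝ E = Fintype.card κ := by
  rw [← finrank_clm_dual, ← finrank_top ℝ (E →L[ℝ] ℝ), ← hsp, finrank_span_eq_card hli]

/-- A smooth coframe has a smooth dual frame. -/
theorem exists_dualFrame [FiniteDimensional ℝ E] {κ : Type*} [Fintype κ] [DecidableEq κ]
    {n : WithTop ℕ∞}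
    {g : κ → E → E →L[ℝ] ℝ} {u₀ : E} (hg : ∀ᶠ u in 𝓝 u₀, ∀ k, ContDiffAt ℝ n (g k) u)
    (hli : LinearIndependent ℝ (fun k ↦ g k u₀))
    (hsp : Submodule.span ℝ (range fun k ↦ g k u₀) = ⊤) :
    ∃ e : κ → E → E, ∀ᶠ u in 𝓝 u₀, (∀ k, ContDiffAt ℝ n (e k) u) ∧
      (∀ v, ∑ k, g k u v • e k u = v) ∧ ∀ i j, g i u (e j u) = if i = j then 1 else 0 := by
  -- The coframe is bundled into one map `E → ℝ^κ`. It is invertible at `u₀`, hence nearby, and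
  -- inversion is smooth; the dual frame is the inverse applied to the standard basis.
  let L : E → E →L[ℝ] (κ → ℝ) := fun u ↦ ∑ k, (g k u).smulRight (Pi.single k (1 : ℝ))
  have hL : ∀ u v k, L u v k = g k u v := by
    intro u v k
    simp [L, Finset.sum_apply, Pi.single_apply]
  have hLs : ∀ᶠ u in 𝓝 u₀, ContDiffAt ℝ n L u := by
    filter_upwards [hg] with u hu
    exact ContDiffAt.sum fun k _ ↦
      (((ContinuousLinearMap.smulRightL ℝ E (κ → ℝ)).flip
        (Pi.single k (1 : ℝ))).contDiff.contDiffAt).comp u (hu k)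
  have hcard : Module.finrank ℝ E = Module.finrank ℝ (κ → ℝ) := by
    rw [Module.finrank_fintype_fun_eq_card, finrank_eq_card_of_coframe hli hsp]
  have hinj : Function.Injective (L u₀ : E →ₗ[ℝ] (κ → ℝ)) := by
    rw [← LinearMap.ker_eq_bot, LinearMap.ker_eq_bot']
    intro v hv
    refine clm_span_separates hsp fun k ↦ ?_
    have := congrFun hv k
    rw [← hL u₀ v k]
    exact this
  let Le : E ≃L[ℝ] (κ → ℝ) :=
    (LinearEquiv.ofInjectiveOfFinrankEq (L u₀ : E →ₗ[ℝ] (κ → ℝ)) hinj hcard).toContinuousLinearEquiv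
  have hLe : (Le : E →L[ℝ] (κ → ℝ)) = L u₀ := by ext; rfl
  have hcomplete : CompleteSpace E := FiniteDimensional.complete ℝ E
  have htend : Tendsto L (𝓝 u₀) (𝓝 (L u₀)) := hLs.self_of_nhds.continuousAt
  have hinv : ∀ᶠ u in 𝓝 u₀, (L u).IsInvertible := by
    have h1 := ContinuousLinearEquiv.nhds Le
    rw [hLe] at h1
    filter_upwards [htend h1] with u hu
    obtain ⟨A, hA⟩ := hu
    exact ⟨A, hA⟩
  refine ⟨fun k u ↦ (L u).inverse (Pi.single k 1), ?_⟩
  filter_upwards [hLs, hinv] with u hu hi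
  refine ⟨fun k ↦ ?_, fun v ↦ ?_, fun i j ↦ ?_⟩
  · exact (hi.contDiffAt_map_inverse.comp u hu).clm_apply contDiffAt_const
  · obtain ⟨A, hA⟩ := hi
    rw [← hA]
    simp only [ContinuousLinearMap.inverse_equiv, ContinuousLinearEquiv.coe_coe, ← map_smul,
      ← map_sum]
    rw [ContinuousLinearEquiv.symm_apply_eq]
    ext k
    have : A v k = g k u v := by rw [← hL, ← hA]; rfl
    simp [Finset.sum_apply, Pi.single_apply, this]
  · rw [← hL]
    obtain ⟨A, hA⟩ := hi
    rw [← hA]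
    simp [Pi.single_apply]

/-- A linearly independent family of covectors extends to a basis. -/
theorem exists_complement_coframe [FiniteDimensional ℝ E] {ι : Type*} [Fintype ι] {m : ℕ}
    {g : ι → E →L[ℝ] ℝ}
    (hli : LinearIndependent ℝ g) (hdim : Module.finrank ℝ E = Fintype.card ι + m) :
    ∃ c : Fin m → E →L[ℝ] ℝ, LinearIndependent ℝ (Sum.elim g c) ∧
      Submodule.span ℝ (range (Sum.elim g c)) = ⊤ :=
  exists_complement_basis hli (finrank_clm_dual.trans hdim)

/-- A basis of covectors has a dual basis of vectors. -/
theorem exists_dual_basis [FiniteDimensional ℝ E] {κ : Type*} [Fintype κ] [DecidableEq κ]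
    {g : κ → E →L[ℝ] ℝ} (hli : LinearIndependent ℝ g)
    (hsp : Submodule.span ℝ (range g) = ⊤) :
    ∃ e : κ → E, (∀ i j, g i (e j) = if i = j then 1 else 0) ∧ ∀ v, ∑ k, g k v • e k = v := by
  obtain ⟨e, he⟩ := exists_dualFrame (n := 0) (g := fun k _ ↦ g k) (u₀ := 0)
    (.of_forall fun u k ↦ contDiffAt_const) hli hsp
  exact ⟨fun k ↦ e k 0, he.self_of_nhds.2.2, he.self_of_nhds.2.1⟩

/-- The value of `dα(v, w)` on the annihilator of a Pfaffian system depends only on the value at the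
point of the section `α` of the system. -/
theorem exists_dForm_eq_apply [FiniteDimensional ℝ E] {ι : Type*} [Fintype ι]
    {g : ι → E → E →L[ℝ] ℝ} {u₀ : E} (hg : ∀ᶠ u in 𝓝 u₀, ∀ i, ContDiffAt ℝ 1 (g i) u)
    (hli : LinearIndependent ℝ (fun i ↦ g i u₀))
    {v w : E} (hv : ∀ i, g i u₀ v = 0) (hw : ∀ i, g i u₀ w = 0) :
    ∃ z, ∀ α : E → E →L[ℝ] ℝ, DifferentiableAt ℝ α u₀ →
      (∀ᶠ u in 𝓝 u₀, α u ∈ Submodule.span ℝ (range fun i ↦ g i u)) →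
      dForm α u₀ v w = α u₀ z := by
  classical
  obtain ⟨m, hm⟩ := Nat.exists_eq_add_of_le (hli.fintype_card_le_finrank.trans_eq finrank_clm_dual)
  obtain ⟨c, hcli, hcsp⟩ := exists_complement_coframe hli hm
  have hc : ∀ u, (fun k ↦ Sum.elim g (fun k _ ↦ c k) k u) = Sum.elim (fun i ↦ g i u) c := by
    intro u; ext k; cases k <;> rfl
  obtain ⟨e, he⟩ := exists_dualFrame (n := 1) (g := Sum.elim g (fun k _ ↦ c k)) (u₀ := u₀)
    (by
      filter_upwards [hg] with u h1
      rintro (i | k)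
      · exact h1 i
      · exact contDiffAt_const)
    (by rwa [hc]) (by rwa [hc])
  -- A vector annihilated at `u₀` extends to an annihilated vector field: keep its coefficients in
  -- the dual frame constant, those along the `g i` being zero.
  have key : ∀ x : E, (∀ i, g i u₀ x = 0) → ∃ X : E → E, DifferentiableAt ℝ X u₀ ∧ X u₀ = x ∧
      ∀ᶠ u in 𝓝 u₀, ∀ i, g i u (X u) = 0 := by
    intro x hx
    refine ⟨fun u ↦ ∑ k, Sum.elim g (fun k _ ↦ c k) k u₀ x • e k u, ?_, he.self_of_nhds.2.1 x, ?_⟩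
    · exact DifferentiableAt.fun_sum fun k _ ↦
        ((he.self_of_nhds.1 k).differentiableAt one_ne_zero).const_smul _
    · filter_upwards [he] with u hu i
      rw [map_sum]
      refine Finset.sum_eq_zero fun k _ ↦ ?_
      have h1 := hu.2.2 (Sum.inl i) k
      rw [Sum.elim_inl] at h1
      rw [map_smul, h1]
      rcases k with k | k <;> simp [hx]
  obtain ⟨X, hX, hXv, hX0⟩ := key v hv
  obtain ⟨Y, hY, hYw, hY0⟩ := key w hw
  -- This is `-[X, Y]` at `u₀`: since `α(X) = α(Y) = 0`, Cartan's formula reduces to `dα(X, Y) =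
  -- -α([X, Y])`. The bracket does not involve `α`.
  refine ⟨fderiv ℝ X u₀ w - fderiv ℝ Y u₀ v, fun α hα hmem ↦ ?_⟩
  have deriv : ∀ Z : E → E, DifferentiableAt ℝ Z u₀ → (∀ᶠ u in 𝓝 u₀, ∀ i, g i u (Z u) = 0) →
      ∀ x, fderiv ℝ α u₀ x (Z u₀) = - α u₀ (fderiv ℝ Z u₀ x) := by
    intro Z hZ hZ0 x
    have h0 : (fun u ↦ α u (Z u)) =ᶠ[𝓝 u₀] fun _ ↦ 0 := by
      filter_upwards [hmem, hZ0] with u hu hu0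
      exact clm_apply_eq_zero_of_mem_span hu (forall_mem_range.2 hu0)
    have h1 := h0.fderiv_eq (𝕜 := ℝ)
    rw [fderiv_clm_apply hα hZ] at h1
    have h2 := congrArg (fun A ↦ A x) h1
    simp at h2
    linarith
  have h1 := deriv X hX hX0 w
  have h2 := deriv Y hY hY0 v
  rw [hXv] at h1
  rw [hYw] at h2
  rw [dForm, h1, h2, (α u₀).map_sub]
  ring

theorem linearIndependent_of_dual {κ : Type*} [Fintype κ] [DecidableEq κ] {g : κ → E →L[ℝ] ℝ}
    {e : κ → E} (h : ∀ i j, g i (e j) = if i = j then 1 else 0) : LinearIndependent ℝ g := by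
  rw [Fintype.linearIndependent_iff]
  intro c hc k
  have := congrArg (fun A ↦ A (e k)) hc
  simpa [_root_.sum_apply, h] using this

theorem span_eq_top_of_dual {κ : Type*} [Fintype κ] {g : κ → E →L[ℝ] ℝ}
    {e : κ → E} (h : ∀ v, ∑ k, g k v • e k = v) : Submodule.span ℝ (range g) = ⊤ := by
  rw [eq_top_iff]
  rintro α -
  have : α = ∑ k, α (e k) • g k := by
    ext v
    conv_lhs => rw [← h v]
    simp [mul_comm]
  rw [this]
  exact Submodule.sum_mem _ fun k _ ↦ Submodule.smul_mem _ _ (Submodule.subset_span ⟨k, rfl⟩)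

/-- An alternating form on a plane scales by the determinant of the coefficients. -/
theorem dForm_eq_mul_of_decomposition (g : E → E →L[ℝ] ℝ) (u e₀ e₁ : E) (a b c d : ℝ) :
    dForm g u (a • e₀ + b • e₁) (c • e₀ + d • e₁) = dForm g u e₀ e₁ * (a * d - c * b) := by
  simp only [dForm, map_add, map_smul, _root_.add_apply, _root_.smul_apply, smul_eq_mul]
  ring

/-- Local normal form of a Pfaffian system of codimension two which is not integrable at `u₀`. -/
theorem exists_normal_form [FiniteDimensional ℝ E] {r : ℕ} {g : Fin r → E → E →L[ℝ] ℝ} {u₀ : E}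
    (hg : ∀ᶠ u in 𝓝 u₀, ∀ i, ContDiffAt ℝ ∞ (g i) u)
    (hli : LinearIndependent ℝ (fun i ↦ g i u₀)) (hdim : Module.finrank ℝ E = r + 2)
    {j : Fin r} {v₀ w₀ : E} (hv₀ : ∀ i, g i u₀ v₀ = 0) (hw₀ : ∀ i, g i u₀ w₀ = 0)
    (hj : dForm (g j) u₀ v₀ w₀ ≠ 0) :
    ∃ (g' : Fin r → E → E →L[ℝ] ℝ) (h : Fin 2 → E → E →L[ℝ] ℝ), ∀ᶠ u in 𝓝 u₀,
      (∀ i, ContDiffAt ℝ ∞ (g' i) u) ∧ (∀ k, ContDiffAt ℝ ∞ (h k) u) ∧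
      Submodule.span ℝ (range (Sum.elim (fun i ↦ g' i u) (fun k ↦ h k u))) = ⊤ ∧
      Submodule.span ℝ (range fun i ↦ g' i u) = Submodule.span ℝ (range fun i ↦ g i u) ∧
      ∀ v w, (∀ i, g i u v = 0) → (∀ i, g i u w = 0) →
        (∀ i ≠ j, dForm (g' i) u v w = 0) ∧
        dForm (g' j) u v w = h 0 u v * h 1 u w - h 0 u w * h 1 u v := by
  classical
  obtain ⟨c, hcli, hcsp⟩ := exists_complement_coframe hli (by rw [hdim, Fintype.card_fin])
  have hG : ∀ u, (fun k ↦ Sum.elim g (fun k _ ↦ c k) k u) = Sum.elim (fun i ↦ g i u) c := by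
    intro u; ext k; cases k <;> rfl
  obtain ⟨e, he⟩ := exists_dualFrame (n := ∞) (g := Sum.elim g (fun k _ ↦ c k)) (u₀ := u₀)
    (by
      filter_upwards [hg] with u h1
      rintro (i | k)
      · exact h1 i
      · exact contDiffAt_const)
    (by rwa [hG]) (by rwa [hG])
  -- The last two dual vectors frame the annihilator, so there `dg i = A i • c 0 ∧ c 1`.
  let A : Fin r → E → ℝ := fun i u ↦ dForm (g i) u (e (.inr 0) u) (e (.inr 1) u)
  have hAs : ∀ᶠ u in 𝓝 u₀, ∀ i, ContDiffAt ℝ ∞ (A i) u := by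
    filter_upwards [hg, he] with u h1 h2 i
    exact contDiffAt_dForm (h1 i) (h2.1 _) (h2.1 _)
  have hdA : ∀ᶠ u in 𝓝 u₀, ∀ i v w, (∀ i, g i u v = 0) → (∀ i, g i u w = 0) →
      dForm (g i) u v w = A i u * (c 0 v * c 1 w - c 0 w * c 1 v) := by
    filter_upwards [he] with u hu i v w hv hw
    have dec : ∀ x, (∀ i, g i u x = 0) → x = c 0 x • e (.inr 0) u + c 1 x • e (.inr 1) u := by
      intro x hx
      conv_lhs => rw [← hu.2.1 x]
      simp [hx]
    conv_lhs => rw [dec v hv, dec w hw]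
    rw [dForm_eq_mul_of_decomposition]
  have hAj : ∀ᶠ u in 𝓝 u₀, A j u ≠ 0 := by
    refine (hAs.self_of_nhds j).continuousAt.eventually_ne fun h0 ↦ hj ?_
    rw [hdA.self_of_nhds j v₀ w₀ hv₀ hw₀, h0, zero_mul]
  -- Subtracting `(A i / A j) g j` cancels the structure form of every `g i` with `i ≠ j`; the value
  -- `0` at `j` keeps `g j` itself. The remaining factor `A j` is absorbed into `h 0`.
  let a : Fin r → E → ℝ := fun i u ↦ if i = j then 0 else A i u / A j u
  have has : ∀ᶠ u in 𝓝 u₀, ∀ i, ContDiffAt ℝ ∞ (a i) u := by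
    filter_upwards [hAs, hAj] with u h1 h2 i
    by_cases hij : i = j
    · simp only [a, hij, if_true]; exact contDiffAt_const
    · simp only [a, hij, if_false]; exact (h1 i).div (h1 j) h2
  let g' : Fin r → E → E →L[ℝ] ℝ := fun i u ↦ g i u - a i u • g j u
  let h : Fin 2 → E → E →L[ℝ] ℝ := ![fun u ↦ A j u • c 0, fun _ ↦ c 1]
  have hg' : ∀ᶠ u in 𝓝 u₀, ∀ i, ContDiffAt ℝ ∞ (g' i) u := by
    filter_upwards [hg, has] with u h1 h2 i
    exact (h1 i).sub ((h2 i).smul (h1 j))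
  have hspan : ∀ u, Submodule.span ℝ (range fun i ↦ g' i u) =
      Submodule.span ℝ (range fun i ↦ g i u) := by
    intro u
    have hj' : g' j u = g j u := by simp [g', a]
    refine le_antisymm (Submodule.span_le.2 ?_) (Submodule.span_le.2 ?_)
    · rintro _ ⟨i, rfl⟩
      exact Submodule.sub_mem _ (Submodule.subset_span ⟨i, rfl⟩)
        (Submodule.smul_mem _ _ (Submodule.subset_span ⟨j, rfl⟩))
    · rintro _ ⟨i, rfl⟩
      have : g i u = g' i u + a i u • g' j u := by rw [hj']; simp [g']
      simp only [this]
      exact Submodule.add_mem _ (Submodule.subset_span ⟨i, rfl⟩)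
        (Submodule.smul_mem _ _ (Submodule.subset_span ⟨j, rfl⟩))
  refine ⟨g', h, ?_⟩
  filter_upwards [hg', hAs, hAj, he, hdA, hg.eventually_nhds] with u hg'u hAu hAju heu hdAu hgu
  refine ⟨hg'u, ?_, ?_, hspan u, ?_⟩
  · intro k
    fin_cases k
    · exact (hAu j).smul contDiffAt_const
    · exact contDiffAt_const
  · have htop := span_eq_top_of_dual heu.2.1
    rw [hG, Sum.elim_range, Submodule.span_union] at htop
    rw [Sum.elim_range, Submodule.span_union, hspan u, eq_top_iff, ← htop]
    refine sup_le_sup_left (Submodule.span_le.2 ?_) _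
    rintro _ ⟨k, rfl⟩
    fin_cases k
    · have : c 0 = (A j u)⁻¹ • h 0 u := by
        simp [h, smul_smul, inv_mul_cancel₀ hAju]
      simp only [Fin.zero_eta, this]
      exact Submodule.smul_mem _ _ (Submodule.subset_span ⟨0, rfl⟩)
    · exact Submodule.subset_span ⟨1, rfl⟩
  · intro v w hv hw
    have hli' := linearIndependent_of_dual heu.2.2
    rw [hG] at hli'
    -- All `dg i` and `dg' i` at `(v, w)` are evaluations at the same vector `z`. Hence `d` is
    -- linear over functions here, and the derivative of `a i` never has to be computed.
    obtain ⟨z, hz⟩ := exists_dForm_eq_apply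
      (hgu.mono fun u hu i ↦ (hu i).of_le (by simp)) (hli'.comp Sum.inl Sum.inl_injective) hv hw
    have hzg : ∀ i, dForm (g i) u v w = g i u z := fun i ↦
      hz _ ((hgu.self_of_nhds i).differentiableAt (by simp))
        (.of_forall fun u ↦ Submodule.subset_span ⟨i, rfl⟩)
    have hzg' : ∀ i, dForm (g' i) u v w = g' i u z := fun i ↦
      hz _ ((hg'u i).differentiableAt (by simp))
        (.of_forall fun u ↦ hspan u ▸ Submodule.subset_span ⟨i, rfl⟩)
    have hd : ∀ i, dForm (g' i) u v w = dForm (g i) u v w - a i u * dForm (g j) u v w := by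
      intro i
      rw [hzg', hzg, hzg]
      simp [g']
    constructor
    · intro i hij
      rw [hd, hdAu i v w hv hw, hdAu j v w hv hw]
      simp only [a, hij, if_false]
      field_simp
      ring
    · rw [hd, hdAu j v w hv hw]
      simp [a, h]
      ring

/-- A linear map which is injective from the annihilator of one system to that of another one, both
of codimension four, is surjective. -/
theorem exists_apply_eq_of_injOn {E' : Type*} [NormedAddCommGroup E'] [NormedSpace ℝ E']
    [FiniteDimensional ℝ E] {ι ι' : Type*} [Fintype ι] {m : ℕ}
    {g : ι → E →L[ℝ] ℝ} (hli : LinearIndependent ℝ g)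
    (hdim : Module.finrank ℝ E = Fintype.card ι + m)
    {a : ι' → E' →L[ℝ] ℝ} {b : Fin m → E' →L[ℝ] ℝ}
    (hsp : Submodule.span ℝ (range (Sum.elim a b)) = ⊤) (Q : E →L[ℝ] E')
    (hQ : ∀ v, (∀ i, g i v = 0) → ∀ i, a i (Q v) = 0)
    (hinj : ∀ v, (∀ i, g i v = 0) → Q v = 0 → v = 0) (c : Fin m → ℝ) :
    ∃ v, (∀ i, g i v = 0) ∧ ∀ k, b k (Q v) = c k := by
  classical
  obtain ⟨h, hhli, hhsp⟩ := exists_complement_coframe hli hdim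
  obtain ⟨e, hdual, -⟩ := exists_dual_basis hhli hhsp
  let P : (Fin m → ℝ) →ₗ[ℝ] E := ∑ l, (LinearMap.proj l).smulRight (e (.inr l))
  have hP : ∀ x, P x = ∑ l, x l • e (.inr l) := fun x ↦ by simp [P]
  have hgP : ∀ x i, g i (P x) = 0 := by
    intro x i
    rw [hP, map_sum]
    refine Finset.sum_eq_zero fun l _ ↦ ?_
    have := hdual (.inl i) (.inr l)
    simp only [Sum.elim_inl] at this
    simp [this]
  have hhP : ∀ x l, h l (P x) = x l := by
    intro x l
    have h1 : ∀ l', h l (e (.inr l')) = if l = l' then 1 else 0 := by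
      intro l'
      simpa using hdual (.inr l) (.inr l')
    rw [hP, map_sum]
    simp [h1]
  let T : (Fin m → ℝ) →ₗ[ℝ] (Fin m → ℝ) :=
    LinearMap.pi fun k ↦ (b k).toLinearMap ∘ₗ Q.toLinearMap ∘ₗ P
  have hT : Function.Injective T := by
    rw [← LinearMap.ker_eq_bot, LinearMap.ker_eq_bot']
    intro x hx
    have h0 : Q (P x) = 0 := by
      refine clm_span_separates hsp ?_
      rintro (i | k)
      · exact hQ _ (hgP x) i
      · exact congrFun hx k
    have h1 := hinj _ (hgP x) h0
    ext l
    rw [← hhP x l, h1, map_zero]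
    rfl
  obtain ⟨x, hx⟩ := LinearMap.injective_iff_surjective.1 hT c
  exact ⟨P x, hgP x, fun k ↦ congrFun hx k⟩

end VectorSpace

/-! ### Smooth 1-forms on manifolds in charts; naturality of the exterior derivative -/

section Forms

variable {E H M E' H' M' : Type*}
  [NormedAddCommGroup E] [NormedSpace ℝ E] [TopologicalSpace H]
  [TopologicalSpace M] [ChartedSpace H M]
  [NormedAddCommGroup E'] [NormedSpace ℝ E'] [TopologicalSpace H']
  [TopologicalSpace M'] [ChartedSpace H' M']
  {J : ModelWithCorners ℝ E H} {J' : ModelWithCorners ℝ E' H'}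

/-- Smoothness of a 1-form at a point, expressed in the preferred chart at that point. -/
def OneForm.SmoothAt (θ : OneForm J M) (x : M) : Prop :=
  ContDiffAt ℝ ∞ (θ.inChart x) (extChartAt J x x)

/-- The pullback of a 1-form. -/
def pullForm (f : M → M') (θ : OneForm J' M') : OneForm J M := fun x ↦ pullback J J' f x (θ (f x))

variable [IsManifold J ∞ M] [J.Boundaryless] [IsManifold J' ∞ M'] [J'.Boundaryless]

theorem contMDiffAt_comp_extChartAt_iff {F : Type*} [NormedAddCommGroup F] [NormedSpace ℝ F]
    {g : E → F} {x : M} :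
    ContMDiffAt J 𝓘(ℝ, F) ∞ (fun y ↦ g (extChartAt J x y)) x ↔
      ContDiffAt ℝ ∞ g (extChartAt J x x) := by
  constructor
  · intro h
    rw [← contMDiffAt_iff_contDiffAt]
    have h1 : ContMDiffAt 𝓘(ℝ, E) J ∞ (extChartAt J x).symm (extChartAt J x x) :=
      (contMDiffOn_extChartAt_symm x).contMDiffAt (extChartAt_target_mem_nhds x)
    have h2 : ContMDiffAt 𝓘(ℝ, E) 𝓘(ℝ, F) ∞
        ((fun y ↦ g (extChartAt J x y)) ∘ (extChartAt J x).symm) (extChartAt J x x) :=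
      ContMDiffAt.comp _ (by rwa [extChartAt_to_inv]) h1
    refine h2.congr_of_eventuallyEq ?_
    filter_upwards [extChartAt_target_mem_nhds (I := J) x] with u hu
    rw [Function.comp_apply, (extChartAt J x).right_inv hu]
  · intro h
    exact (contMDiffAt_iff_contDiffAt.2 h).comp x contMDiffAt_extChartAt

/-- In the bundle trivialization centred at `x`, the fibre coordinate of `θ y` is `θ y` composed
with the derivative of the inverse chart, which is `θ.inChart x` read at the coordinates of `y`. -/
theorem OneForm.smoothOn_iff {θ : OneForm J M} {U : Set M} (hU : IsOpen U) :
    θ.SmoothOn U ↔ ∀ x ∈ U, θ.SmoothAt x := by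
  have : IsManifold J 1 M := IsManifold.of_le (n := ∞) (by simp)
  have hon : θ.SmoothOn U ↔ ∀ x ∈ U, ContMDiffAt J (J.prod 𝓘(ℝ, E →L[ℝ] ℝ)) ∞
      (fun x ↦ Bundle.TotalSpace.mk' (E →L[ℝ] ℝ)
        (E := fun x : M ↦ TangentSpace J x →L[ℝ] Bundle.Trivial M ℝ x) x (θ x)) x :=
    ⟨fun h x hx ↦ (h x hx).contMDiffAt (hU.mem_nhds hx), fun h x hx ↦ (h x hx).contMDiffWithinAt⟩
  rw [hon]
  refine forall₂_congr fun x _ ↦ ?_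
  rw [contMDiffAt_hom_bundle, OneForm.SmoothAt, ← contMDiffAt_comp_extChartAt_iff]
  refine (and_iff_right (contMDiffAt_id (I := J) (n := ∞) (x := x))).trans ?_
  refine Filter.EventuallyEq.contMDiffAt_iff ?_
  filter_upwards [chart_source_mem_nhds H x] with y hy
  have hy' : (extChartAt J x).symm (extChartAt J x y) = y :=
    (extChartAt J x).left_inv (by rwa [extChartAt_source])
  have hs := TangentBundle.symmL_trivializationAt (I := J) hy
  rw [J.range_eq_univ, mfderivWithin_univ] at hs
  change ((trivializationAt ℝ (Bundle.Trivial M ℝ) x).continuousLinearMapAt ℝ y).comp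
    ((θ y).comp ((trivializationAt E (TangentSpace J) x).symmL ℝ y)) = _
  rw [hs]
  ext v
  let θ' : M → E →L[ℝ] ℝ := θ
  change (trivializationAt ℝ (Bundle.Trivial M ℝ) x).continuousLinearMapAt ℝ y (θ' y _) =
    θ' ((extChartAt J x).symm (extChartAt J x y)) _
  rw [hy']
  exact DFunLike.congr_fun (Bundle.Trivial.continuousLinearMapAt_trivialization ℝ M ℝ y) _

/-- The chain rule, with the target chart and its inverse inserted after `f`. It reduces naturality
on manifolds to `dForm_comp`. -/
theorem OneForm.inChart_pullForm {f : M → M'} {θ : OneForm J' M'} {x : M}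
    (hf : ContMDiffAt J J' ∞ f x) :
    ∀ᶠ u in 𝓝 (extChartAt J x x), (pullForm (J := J) f θ).inChart x u =
      (θ.inChart (f x) (writtenInExtChartAt J J' x f u)).comp
        (fderiv ℝ (writtenInExtChartAt J J' x f) u) := by
  have : IsManifold J 1 M := IsManifold.of_le (n := ∞) (by simp)
  have : IsManifold J' 1 M' := IsManifold.of_le (n := ∞) (by simp)
  have hf1 : ∀ᶠ y in 𝓝 x, ContMDiffAt J J' 1 f y :=
    (contMDiffAt_iff_contMDiffAt_nhds (by simp)).1 (hf.of_le (by exact_mod_cast le_top))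
  have hs : ∀ᶠ y in 𝓝 x, f y ∈ (extChartAt J' (f x)).source :=
    hf.continuousAt (extChartAt_source_mem_nhds (f x))
  have hsymm : Tendsto (extChartAt J x).symm (𝓝 (extChartAt J x x)) (𝓝 x) := by
    have := continuousAt_extChartAt_symm (I := J) x
    rwa [ContinuousAt, extChartAt_to_inv] at this
  filter_upwards [extChartAt_target_mem_nhds (I := J) x, hsymm hf1, hsymm hs] with u hu hfu hsu
  have h1 : MDifferentiableAt 𝓘(ℝ, E) J (extChartAt J x).symm u := by
    have := mdifferentiableWithinAt_extChartAt_symm (I := J) hu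
    rwa [J.range_eq_univ, mdifferentiableWithinAt_univ] at this
  have h2 : MDifferentiableAt J J' f ((extChartAt J x).symm u) := hfu.mdifferentiableAt (by simp)
  have h3 : MDifferentiableAt J' 𝓘(ℝ, E') (extChartAt J' (f x)) (f ((extChartAt J x).symm u)) :=
    mdifferentiableAt_extChartAt (by rwa [← extChartAt_source (I := J')])
  have h4 : fderiv ℝ (writtenInExtChartAt J J' x f) u =
      (mfderiv J' 𝓘(ℝ, E') (extChartAt J' (f x)) (f ((extChartAt J x).symm u))).comp
        ((mfderiv J J' f ((extChartAt J x).symm u)).comp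
          (mfderiv 𝓘(ℝ, E) J (extChartAt J x).symm u)) := by
    rw [← mfderiv_eq_fderiv, ← mfderiv_comp u h2 h1]
    exact mfderiv_comp u h3 (h2.comp u h1)
  have h5 := mfderivWithin_extChartAt_symm_comp_mfderiv_extChartAt' (I := J') hsu
  rw [J'.range_eq_univ, mfderivWithin_univ] at h5
  ext v
  have h6 := DFunLike.congr_fun h5 (mfderiv J J' f ((extChartAt J x).symm u)
    (mfderiv 𝓘(ℝ, E) J (extChartAt J x).symm u v))
  have h7 : (extChartAt J' (f x)).symm (writtenInExtChartAt J J' x f u) =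
      f ((extChartAt J x).symm u) := (extChartAt J' (f x)).left_inv hsu
  let θ' : M' → E' →L[ℝ] ℝ := θ
  change θ' (f ((extChartAt J x).symm u)) _ =
    θ' ((extChartAt J' (f x)).symm (writtenInExtChartAt J J' x f u)) _
  rw [h7, h4]
  exact congrArg _ h6.symm

/-- The preferred chart at `x` has the identity as its derivative at `x` itself, so the tangent
vectors need no conversion. -/
theorem OneForm.d_eq_dForm {θ : OneForm J M} {x : M} (hθ : θ.SmoothAt x)
    (v w : TangentSpace J x) :
    θ.d x v w = dForm (θ.inChart x) (extChartAt J x x) v w := by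
  have : IsManifold J 1 M := IsManifold.of_le (n := ∞) (by simp)
  rw [OneForm.d, mfderiv_extChartAt_self]
  exact extDeriv_ofSubsingleton_apply _ _ _ _ (ContDiffAt.differentiableAt hθ (by simp))

theorem contDiffAt_writtenInExtChartAt {f : M → M'} {x : M} (hf : ContMDiffAt J J' ∞ f x) :
    ContDiffAt ℝ ∞ (writtenInExtChartAt J J' x f) (extChartAt J x x) := by
  have := (contMDiffAt_iff.1 hf).2
  rwa [J.range_eq_univ, contDiffWithinAt_univ] at this

theorem OneForm.SmoothAt.pullForm {f : M → M'} {θ : OneForm J' M'} {x : M}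
    (hθ : θ.SmoothAt (f x)) (hf : ContMDiffAt J J' ∞ f x) :
    (pullForm (J := J) f θ).SmoothAt x := by
  have hF := contDiffAt_writtenInExtChartAt hf
  refine ContDiffAt.congr_of_eventuallyEq ?_ (OneForm.inChart_pullForm hf)
  have hx : writtenInExtChartAt J J' x f (extChartAt J x x) = extChartAt J' (f x) (f x) := by
    rw [writtenInExtChartAt, Function.comp_apply, Function.comp_apply, extChartAt_to_inv]
  have hθ' : ContDiffAt ℝ ∞ (θ.inChart (f x)) (writtenInExtChartAt J J' x f (extChartAt J x x)) := by
    rw [hx]; exact hθ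
  exact (ContDiffAt.comp (extChartAt J x x) hθ' hF).clm_comp (hF.fderiv_right (by simp))

/-- Naturality of the exterior derivative of 1-forms. -/
theorem OneForm.d_pullForm {f : M → M'} {θ : OneForm J' M'} {x : M}
    (hθ : θ.SmoothAt (f x)) (hf : ContMDiffAt J J' ∞ f x) (v w : TangentSpace J x) :
    (pullForm (J := J) f θ).d x v w = θ.d (f x) (mfderiv J J' f x v) (mfderiv J J' f x w) := by
  have hF := contDiffAt_writtenInExtChartAt hf
  have hx : writtenInExtChartAt J J' x f (extChartAt J x x) = extChartAt J' (f x) (f x) := by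
    rw [writtenInExtChartAt, Function.comp_apply, Function.comp_apply, extChartAt_to_inv]
  have hm : mfderiv J J' f x = fderiv ℝ (writtenInExtChartAt J J' x f) (extChartAt J x x) := by
    rw [(hf.mdifferentiableAt (by simp)).mfderiv, J.range_eq_univ, fderivWithin_univ]
  rw [OneForm.d_eq_dForm (hθ.pullForm hf), OneForm.d_eq_dForm hθ]
  refine (dForm_congr (OneForm.inChart_pullForm hf) _ _).trans ?_
  rw [hm]
  have := dForm_comp (g := θ.inChart (f x)) (F := writtenInExtChartAt J J' x f)
    (u := extChartAt J x x) (by rw [hx]; exact ContDiffAt.differentiableAt hθ (by simp))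
    (hF.of_le (by norm_cast)) v w
  rw [hx] at this
  exact this

/-- A 1-form near `x` is determined by its expression in the chart at `x`. -/
theorem OneForm.pullForm_inChart (θ : OneForm J M) {x y : M} (hy : y ∈ (extChartAt J x).source) :
    pullForm (J := J) (J' := 𝓘(ℝ, E)) (extChartAt J x) (θ.inChart x) y = θ y := by
  have : IsManifold J 1 M := IsManifold.of_le (n := ∞) (by simp)
  have h5 := mfderivWithin_extChartAt_symm_comp_mfderiv_extChartAt' (I := J) hy
  rw [J.range_eq_univ, mfderivWithin_univ] at h5
  ext v
  have h6 := DFunLike.congr_fun h5 v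
  let θ' : M → E →L[ℝ] ℝ := θ
  change θ' ((extChartAt J x).symm (extChartAt J x y)) _ = θ' y _
  rw [(extChartAt J x).left_inv hy]
  exact congrArg _ h6

theorem OneForm.inChart_modelSpace (g : OneForm 𝓘(ℝ, E) E) (u : E) : g.inChart u = g := by
  ext z v
  have h : mfderiv 𝓘(ℝ, E) 𝓘(ℝ, E) (extChartAt 𝓘(ℝ, E) u).symm z = ContinuousLinearMap.id ℝ E := by
    have : ((extChartAt 𝓘(ℝ, E) u).symm : E → E) = id := by
      ext; simp [chartAt_self_eq]
    rw [this]; exact mfderiv_id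
  change g z (mfderiv 𝓘(ℝ, E) 𝓘(ℝ, E) (extChartAt 𝓘(ℝ, E) u).symm z v) = g z v
  rw [h]
  rfl

theorem OneForm.smoothAt_iff_contDiffAt {g : E → E →L[ℝ] ℝ} {u : E} :
    OneForm.SmoothAt (J := 𝓘(ℝ, E)) (M := E) g u ↔ ContDiffAt ℝ ∞ g u := by
  have h := OneForm.inChart_modelSpace (E := E) g u
  change ContDiffAt ℝ ∞ (OneForm.inChart (J := 𝓘(ℝ, E)) (M := E) g u) u ↔ _
  rw [h]

theorem OneForm.d_modelSpace {g : E → E →L[ℝ] ℝ} {u : E} (hg : ContDiffAt ℝ ∞ g u) (v w : E) :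
    OneForm.d (J := 𝓘(ℝ, E)) (M := E) g u v w = dForm g u v w := by
  refine (OneForm.d_eq_dForm (OneForm.smoothAt_iff_contDiffAt.2 hg) v w).trans ?_
  exact congrArg (fun g' : E → E →L[ℝ] ℝ ↦ dForm g' u v w) (OneForm.inChart_modelSpace (E := E) g u)

end Forms

/-! ### Structure forms of local frames of a Pfaffian system -/

section LocalFrames

variable {E H M E' H' M' : Type*}
  [NormedAddCommGroup E] [NormedSpace ℝ E] [TopologicalSpace H]
  [TopologicalSpace M] [ChartedSpace H M]
  [NormedAddCommGroup E'] [NormedSpace ℝ E'] [TopologicalSpace H']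
  [TopologicalSpace M'] [ChartedSpace H' M']
  {J : ModelWithCorners ℝ E H} {J' : ModelWithCorners ℝ E' H'}

theorem mem_ann_span_range {ι : Type*} {x : M} {θ : ι → Cotangent J x} {v : TangentSpace J x} :
    v ∈ ann (Submodule.span ℝ (range θ)) ↔ ∀ i, θ i v = 0 :=
  ⟨fun h i ↦ h _ (Submodule.subset_span ⟨i, rfl⟩), fun h _ hα ↦
    clm_apply_eq_zero_of_mem_span (E := E) hα (forall_mem_range.2 h)⟩

theorem clm_comp_mem_span {ι : Type*} {a : ι → E' →L[ℝ] ℝ} {α : E' →L[ℝ] ℝ}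
    (h : α ∈ Submodule.span ℝ (range a)) (A : E →L[ℝ] E') :
    α.comp A ∈ Submodule.span ℝ (range fun i ↦ (a i).comp A) := by
  have := Submodule.mem_map_of_mem (f := ((ContinuousLinearMap.compL ℝ E E' ℝ).flip A).toLinearMap) h
  rw [Submodule.map_span, ← range_comp] at this
  exact this

theorem span_range_pullback {ι : Type*} (f : M → M') (x : M) (a : ι → Cotangent J' (f x)) :
    Submodule.span ℝ (range fun i ↦ pullback J J' f x (a i)) =
      (Submodule.span ℝ (range a)).map (pullback J J' f x) := by
  rw [Submodule.map_span, ← range_comp]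
  rfl

variable [IsManifold J ∞ M] [J.Boundaryless] [IsManifold J' ∞ M'] [J'.Boundaryless]

theorem OneForm.inChart_self (θ : OneForm J M) (x : M) :
    θ.inChart x (extChartAt J x x) = θ x := by
  have : IsManifold J 1 M := IsManifold.of_le (n := ∞) (by simp)
  have h := mfderivWithin_range_extChartAt_symm (I := J) (x := x)
  rw [J.range_eq_univ, mfderivWithin_univ] at h
  let θ' : M → E →L[ℝ] ℝ := θ
  ext v
  change θ' ((extChartAt J x).symm (extChartAt J x x))
    (mfderiv 𝓘(ℝ, E) J (extChartAt J x).symm (extChartAt J x x) v) = θ' x v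
  rw [h, extChartAt_to_inv]
  rfl

theorem OneForm.SmoothAt.contDiffAt_inChart {θ : OneForm J M} {x : M} {u : E}
    (hu : u ∈ (extChartAt J x).target) (hθ : θ.SmoothAt ((extChartAt J x).symm u)) :
    ContDiffAt ℝ ∞ (θ.inChart x) u :=
  OneForm.smoothAt_iff_contDiffAt.1 (hθ.pullForm ((contMDiffOn_extChartAt_symm x).contMDiffAt
    ((isOpen_extChartAt_target x).mem_nhds hu)))

/-- The value of `dα(v, w)` on the annihilator of a Pfaffian system depends only on the value at the
point of the section `α` of the system. -/
theorem exists_d_eq_apply [FiniteDimensional ℝ E] {ι : Type*} [Fintype ι]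
    {θ : ι → OneForm J M} {x : M} (hθ : ∀ i, (θ i).SmoothAt x)
    (hli : LinearIndependent ℝ (fun i ↦ θ i x))
    {v w : TangentSpace J x} (hv : ∀ i, θ i x v = 0) (hw : ∀ i, θ i x w = 0) :
    ∃ z : TangentSpace J x, ∀ α : OneForm J M, α.SmoothAt x →
      (∀ᶠ y in 𝓝 x, α y ∈ Submodule.span ℝ (range fun i ↦ θ i y)) → α.d x v w = α x z := by
  have ev : ∀ α : OneForm J M, α.SmoothAt x →
      ∀ᶠ u in 𝓝 (extChartAt J x x), ContDiffAt ℝ 1 (α.inChart x) u := fun α hα ↦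
    (ContDiffAt.of_le hα (by simp)).eventually (by simp)
  have hself : (fun i ↦ (θ i).inChart x (extChartAt J x x)) = fun i ↦ θ i x :=
    funext fun i ↦ OneForm.inChart_self _ _
  obtain ⟨z, hz⟩ := exists_dForm_eq_apply (E := E) (g := fun i ↦ (θ i).inChart x)
    (u₀ := extChartAt J x x) (eventually_all.2 fun i ↦ ev _ (hθ i))
    (by rw [hself]; exact hli) (v := v) (w := w)
    (fun i ↦ by rw [OneForm.inChart_self]; exact hv i)
    (fun i ↦ by rw [OneForm.inChart_self]; exact hw i)
  refine ⟨z, fun α hα hmem ↦ ?_⟩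
  have hsymm : Tendsto (extChartAt J x).symm (𝓝 (extChartAt J x x)) (𝓝 x) := by
    have := continuousAt_extChartAt_symm (I := J) x
    rwa [ContinuousAt, extChartAt_to_inv] at this
  rw [OneForm.d_eq_dForm hα]
  refine (hz _ (ContDiffAt.differentiableAt hα (by simp)) ?_).trans ?_
  · filter_upwards [hsymm hmem] with u hu
    exact clm_comp_mem_span (E := E) (E' := E) hu _
  · rw [OneForm.inChart_self]; rfl

theorem pullback_extChartAt_surjective {x y : M} (hy : y ∈ (extChartAt J x).source) :
    Function.Surjective (pullback J 𝓘(ℝ, E) (extChartAt J x) y) := by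
  have : IsManifold J 1 M := IsManifold.of_le (n := ∞) (by simp)
  intro α
  have h := mfderivWithin_extChartAt_symm_comp_mfderiv_extChartAt' (I := J) hy
  refine ⟨ContinuousLinearMap.comp (M₁ := E) (M₂ := E) α
    (mfderivWithin 𝓘(ℝ, E) J (extChartAt J x).symm (range J) (extChartAt J x y)), ?_⟩
  ext v
  exact congrArg α (DFunLike.congr_fun h v)

/-- Local normal form of a Pfaffian system of codimension two which is not integrable at `x`. -/
theorem exists_local_normal_form [FiniteDimensional ℝ E] {r : ℕ} {θ : Fin r → OneForm J M}
    {U : Set M} (hU : IsOpen U) {x : M} (hx : x ∈ U) (hθ : ∀ i, ∀ y ∈ U, (θ i).SmoothAt y)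
    (hli : LinearIndependent ℝ (fun i ↦ θ i x)) (hdim : Module.finrank ℝ E = r + 2)
    {j : Fin r} {v₀ w₀ : TangentSpace J x} (hv₀ : ∀ i, θ i x v₀ = 0) (hw₀ : ∀ i, θ i x w₀ = 0)
    (hj : (θ j).d x v₀ w₀ ≠ 0) :
    ∃ U' ⊆ U, IsOpen U' ∧ x ∈ U' ∧ ∃ (θ' : Fin r → OneForm J M) (η : Fin 2 → OneForm J M),
      ∀ y ∈ U', (∀ i, (θ' i).SmoothAt y) ∧ (∀ k, (η k).SmoothAt y) ∧
      Submodule.span ℝ (range (Sum.elim (fun i ↦ θ' i y) (fun k ↦ η k y))) = ⊤ ∧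
      Submodule.span ℝ (range fun i ↦ θ' i y) = Submodule.span ℝ (range fun i ↦ θ i y) ∧
      ∀ v w, (∀ i, θ i y v = 0) → (∀ i, θ i y w = 0) →
        (∀ i ≠ j, (θ' i).d y v w = 0) ∧ (θ' j).d y v w = wedge (η 0 y) (η 1 y) v w := by
  have hsymm : Tendsto (extChartAt J x).symm (𝓝 (extChartAt J x x)) (𝓝 x) := by
    have := continuousAt_extChartAt_symm (I := J) x
    rwa [ContinuousAt, extChartAt_to_inv] at this
  have hself : (fun i ↦ (θ i).inChart x (extChartAt J x x)) = fun i ↦ θ i x :=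
    funext fun i ↦ OneForm.inChart_self _ _
  obtain ⟨g', h, hgh⟩ := exists_normal_form (E := E) (g := fun i ↦ (θ i).inChart x)
    (u₀ := extChartAt J x x)
    (by
      filter_upwards [hsymm (hU.mem_nhds hx), extChartAt_target_mem_nhds (I := J) x] with u h1 h2 i
      exact (hθ i _ h1).contDiffAt_inChart h2)
    (by rw [hself]; exact hli) hdim (j := j) (v₀ := v₀) (w₀ := w₀)
    (fun i ↦ by rw [OneForm.inChart_self]; exact hv₀ i)
    (fun i ↦ by rw [OneForm.inChart_self]; exact hw₀ i)
    (by rw [OneForm.d_eq_dForm (hθ j x hx)] at hj; exact hj)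
  -- The normal form found in coordinates is carried back by the chart; naturality of `d` preserves
  -- its structure equations.
  let θ' : Fin r → OneForm J M := fun i ↦ pullForm (J' := 𝓘(ℝ, E)) (extChartAt J x) (g' i)
  let η : Fin 2 → OneForm J M := fun i ↦ pullForm (J' := 𝓘(ℝ, E)) (extChartAt J x) (h i)
  obtain ⟨U', hU'sub, hU'o, hxU'⟩ := eventually_nhds_iff.1 (((continuousAt_extChartAt (I := J)
    x).eventually hgh).and (Filter.Eventually.and
      (show ∀ᶠ y in 𝓝 x, y ∈ (extChartAt J x).source from extChartAt_source_mem_nhds x)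
      (show ∀ᶠ y in 𝓝 x, y ∈ U from hU.mem_nhds hx)))
  refine ⟨U', fun y hy ↦ (hU'sub y hy).2.2, hU'o, hxU', θ', η, fun y hy ↦ ?_⟩
  obtain ⟨⟨hg's, hhs, hsp, hspan, hd⟩, hys, hyU⟩ := hU'sub y hy
  have hφ : ContMDiffAt J 𝓘(ℝ, E) ∞ (extChartAt J x) y :=
    contMDiffAt_extChartAt' (by rwa [← extChartAt_source (I := J)])
  have hθ_eq : ∀ i, θ i y = pullback J 𝓘(ℝ, E) (extChartAt J x) y
      ((θ i).inChart x (extChartAt J x y)) := fun i ↦ (OneForm.pullForm_inChart (θ i) hys).symm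
  refine ⟨fun i ↦ (OneForm.smoothAt_iff_contDiffAt.2 (hg's i)).pullForm hφ,
    fun k ↦ (OneForm.smoothAt_iff_contDiffAt.2 (hhs k)).pullForm hφ, ?_, ?_, ?_⟩
  · have e : Sum.elim (fun i ↦ θ' i y) (fun k ↦ η k y) = fun k ↦
        pullback J 𝓘(ℝ, E) (extChartAt J x) y (Sum.elim (fun i ↦ g' i (extChartAt J x y))
          (fun k ↦ h k (extChartAt J x y)) k) := by
      ext k : 1; cases k <;> rfl
    rw [e, span_range_pullback]
    exact (congrArg (Submodule.map _) hsp).trans ((Submodule.map_top _).trans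
      (LinearMap.range_eq_top.2 (pullback_extChartAt_surjective hys)))
  · rw [funext hθ_eq]
    exact (span_range_pullback _ _ _).trans ((congrArg (Submodule.map _) hspan).trans
      (span_range_pullback _ _ _).symm)
  · intro v w hv hw
    have ker : ∀ v, (∀ i, θ i y v = 0) → ∀ i, (θ i).inChart x (extChartAt J x y)
        (mfderiv J 𝓘(ℝ, E) (extChartAt J x) y v) = 0 := by
      intro v hv i
      have := hv i
      rw [hθ_eq] at this
      exact this
    have hd' := hd _ _ (ker v hv) (ker w hw)
    have hdθ : ∀ i, (θ' i).d y v w = dForm (g' i) (extChartAt J x y)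
        (mfderiv J 𝓘(ℝ, E) (extChartAt J x) y v) (mfderiv J 𝓘(ℝ, E) (extChartAt J x) y w) := by
      intro i
      refine (OneForm.d_pullForm (OneForm.smoothAt_iff_contDiffAt.2 (hg's i)) hφ v w).trans ?_
      exact OneForm.d_modelSpace (hg's i) _ _
    exact ⟨fun i hi ↦ (hdθ i).trans (hd'.1 i hi), (hdθ j).trans hd'.2⟩

/-- The 2-forms `dα` of the sections `α` of a Pfaffian system are, modulo the system, combinations of
those of a local frame. -/
theorem exists_d_eq_sum [FiniteDimensional ℝ E] {ι : Type*} [Fintype ι]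
    {θ : ι → OneForm J M} {x : M} (hθ : ∀ i, (θ i).SmoothAt x)
    (hli : LinearIndependent ℝ (fun i ↦ θ i x)) {α : OneForm J M} (hα : α.SmoothAt x)
    (hmem : ∀ᶠ y in 𝓝 x, α y ∈ Submodule.span ℝ (range fun i ↦ θ i y)) :
    ∃ c : ι → ℝ, ∀ v w, (∀ i, θ i x v = 0) → (∀ i, θ i x w = 0) →
      α.d x v w = ∑ i, c i * (θ i).d x v w := by
  obtain ⟨c, hc⟩ := (Submodule.mem_span_range_iff_exists_fun ℝ).1 hmem.self_of_nhds
  refine ⟨c, fun v w hv hw ↦ ?_⟩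
  -- One `z` serves `α` and every `θ i`, so the pointwise expansion of `α` in the frame carries over
  -- to `dα`.
  obtain ⟨z, hz⟩ := exists_d_eq_apply hθ hli hv hw
  rw [hz α hα hmem, ← hc]
  have hzθ : ∀ i, (θ i).d x v w = θ i x z := fun i ↦
    hz _ (hθ i) (.of_forall fun y ↦ Submodule.subset_span ⟨i, rfl⟩)
  simp_rw [hzθ]
  refine (sum_apply (F := E →L[ℝ] ℝ) _ _ _).trans ?_
  rfl

/-- A 2-form restricted to the two-dimensional annihilator of a Pfaffian system of codimension two
is a multiple of a fixed one. -/
theorem exists_d_eq_mul_wedge [FiniteDimensional ℝ E] {r : ℕ} {θ : Fin r → OneForm J M} {x : M}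
    (hli : LinearIndependent ℝ (fun i ↦ θ i x)) (hdim : Module.finrank ℝ E = r + 2) :
    ∃ c : Fin 2 → Cotangent J x, ∀ α : OneForm J M, α.SmoothAt x → ∃ a : ℝ, ∀ v w,
      (∀ i, θ i x v = 0) → (∀ i, θ i x w = 0) → α.d x v w = a * wedge (c 0) (c 1) v w := by
  obtain ⟨c, hcli, hcsp⟩ := exists_complement_coframe (E := E) (ι := Fin r) hli
    (by rw [hdim, Fintype.card_fin])
  obtain ⟨e, -, he⟩ := exists_dual_basis hcli hcsp
  refine ⟨c, fun α hα ↦ ⟨dForm (α.inChart x) (extChartAt J x x) (e (.inr 0)) (e (.inr 1)),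
    fun v w hv hw ↦ ?_⟩⟩
  have dec : ∀ x', (∀ i, θ i x x' = 0) → x' = c 0 x' • e (.inr 0) + c 1 x' • e (.inr 1) := by
    intro x' hx'
    refine (he x').symm.trans ?_
    rw [Fintype.sum_sum_type, Fin.sum_univ_two]
    refine (congrArg (· + _) (Finset.sum_eq_zero fun i _ ↦ ?_)).trans (zero_add _)
    exact (congrArg (· • _) (hx' i)).trans (zero_smul _ _)
  rw [OneForm.d_eq_dForm hα]
  refine Eq.trans ?_ (dForm_eq_mul_of_decomposition _ _ _ _ (c 0 v) (c 1 v) (c 0 w) (c 1 w))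
  exact congrArg₂ _ (dec v hv) (dec w hw)

end LocalFrames

/-! ### Sums of systems on a product manifold -/

section SumSystems

variable {E H M E' H' M' : Type*}
  [NormedAddCommGroup E] [NormedSpace ℝ E] [TopologicalSpace H]
  [TopologicalSpace M] [ChartedSpace H M]
  [NormedAddCommGroup E'] [NormedSpace ℝ E'] [TopologicalSpace H']
  [TopologicalSpace M'] [ChartedSpace H' M']
  {J : ModelWithCorners ℝ E H} {J' : ModelWithCorners ℝ E' H'}

theorem ann_anti {x : M} {S T : Submodule ℝ (Cotangent J x)} (h : S ≤ T) : ann T ≤ ann S :=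
  fun _ hv α hα ↦ hv α (h hα)

theorem sumSystem_mono {K L : CotangentFamily J M} {K' L' : CotangentFamily J' M'}
    (h : ∀ x, K x ≤ L x) (h' : ∀ x, K' x ≤ L' x) (p : M × M') :
    sumSystem K K' p ≤ sumSystem L L' p :=
  sup_le_sup (Submodule.map_mono (h p.1)) (Submodule.map_mono (h' p.2))

theorem derivedSystem_le [IsManifold J ∞ M] (K : CotangentFamily J M) (x : M) :
    derivedSystem K x ≤ K x := by
  refine Submodule.span_le.2 ?_
  rintro _ ⟨θ, U, -, hx, -, hθ, rfl⟩
  exact (hθ x hx).1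

/-- The sum of two families of 1-forms, on the product manifold. -/
def sumForms {ι ι' : Type*} (θ : ι → OneForm J M) (θ' : ι' → OneForm J' M') :
    ι ⊕ ι' → OneForm (J.prod J') (M × M') :=
  Sum.elim (fun i ↦ pullForm Prod.fst (θ i)) (fun i ↦ pullForm Prod.snd (θ' i))

theorem pullback_fst_apply {p : M × M'} (α : Cotangent J p.1) (v : TangentSpace (J.prod J') p) :
    pullback (J.prod J') J (Prod.fst : M × M' → M) p α v = α (Prod.fst (α := E) (β := E') v) := by
  change α (mfderiv (J.prod J') J Prod.fst p v) = _
  rw [mfderiv_fst]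
  rfl

theorem pullback_snd_apply {p : M × M'} (α : Cotangent J' p.2) (v : TangentSpace (J.prod J') p) :
    pullback (J.prod J') J' (Prod.snd : M × M' → M') p α v = α (Prod.snd (α := E) (β := E') v) := by
  change α (mfderiv (J.prod J') J' Prod.snd p v) = _
  rw [mfderiv_snd]
  rfl

theorem span_sumForms {ι ι' : Type*} {θ : ι → OneForm J M} {θ' : ι' → OneForm J' M'}
    {K : CotangentFamily J M} {K' : CotangentFamily J' M'} {p : M × M'}
    (hK : K p.1 = Submodule.span ℝ (range fun i ↦ θ i p.1))
    (hK' : K' p.2 = Submodule.span ℝ (range fun i ↦ θ' i p.2)) :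
    sumSystem K K' p = Submodule.span ℝ (range fun i ↦ sumForms θ θ' i p) := by
  have : (fun i ↦ sumForms θ θ' i p) =
      Sum.elim (fun i ↦ pullback (J.prod J') J Prod.fst p (θ i p.1))
        (fun i ↦ pullback (J.prod J') J' Prod.snd p (θ' i p.2)) := by
    ext k : 1; cases k <;> rfl
  rw [this, Sum.elim_range, Submodule.span_union, sumSystem, hK, hK', span_range_pullback,
    span_range_pullback]

/-- Vectors `(v, 0)` and `(0, v)` detect the two kinds of pulled back covectors separately: both
pullbacks are injective and their images meet in zero. -/
theorem linearIndependent_sumForms {ι ι' : Type*} {θ : ι → OneForm J M} {θ' : ι' → OneForm J' M'}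
    {p : M × M'} (h : LinearIndependent ℝ (fun i ↦ θ i p.1))
    (h' : LinearIndependent ℝ (fun i ↦ θ' i p.2)) :
    LinearIndependent ℝ (fun i ↦ sumForms θ θ' i p) := by
  have e : (fun i ↦ sumForms θ θ' i p) =
      Sum.elim (pullback (J.prod J') J Prod.fst p ∘ fun i ↦ θ i p.1)
        (pullback (J.prod J') J' Prod.snd p ∘ fun i ↦ θ' i p.2) := by
    ext k : 1; cases k <;> rfl
  rw [e]
  refine (h.map' _ ?_).sum_type (h'.map' _ ?_) ?_
  · rw [LinearMap.ker_eq_bot']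
    intro α hα
    ext v
    have := DFunLike.congr_fun hα ((v, 0) : E × E')
    exact (pullback_fst_apply α _).symm.trans this
  · rw [LinearMap.ker_eq_bot']
    intro α hα
    ext v
    have := DFunLike.congr_fun hα ((0, v) : E × E')
    exact (pullback_snd_apply α _).symm.trans this
  · rw [Submodule.disjoint_def]
    intro α hα hα'
    rw [range_comp, ← Submodule.map_span] at hα hα'
    obtain ⟨β, -, rfl⟩ := hα
    obtain ⟨β', -, hβ'⟩ := hα'
    ext v
    have h1 := DFunLike.congr_fun hβ' ((v.1, 0) : E × E')
    exact (pullback_fst_apply β v).trans ((pullback_fst_apply (p := p) β (v.1, (0 : E'))).symm.trans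
      (h1.symm.trans ((pullback_snd_apply β' _).trans (map_zero β'))))

theorem sumSystem_top (p : M × M') :
    sumSystem (fun x : M ↦ (⊤ : Submodule ℝ (Cotangent J x)))
      (fun x : M' ↦ (⊤ : Submodule ℝ (Cotangent J' x))) p = ⊤ := by
  rw [eq_top_iff]
  rintro α -
  let α' : E × E' →L[ℝ] ℝ := α
  have : α = pullback (J.prod J') J Prod.fst p (α'.comp (ContinuousLinearMap.inl ℝ E E')) +
      pullback (J.prod J') J' Prod.snd p (α'.comp (ContinuousLinearMap.inr ℝ E E')) := by
    ext v
    refine Eq.trans ?_ (congrArg₂ (· + ·) (pullback_fst_apply _ v) (pullback_snd_apply _ v)).symm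
    change α' v = α' (v.1, 0) + α' (0, v.2)
    rw [← map_add, Prod.mk_add_mk, add_zero, zero_add]
    rfl
  rw [this]
  exact Submodule.add_mem_sup (Submodule.mem_map_of_mem Submodule.mem_top)
    (Submodule.mem_map_of_mem Submodule.mem_top)

variable [IsManifold J ∞ M] [J.Boundaryless] [IsManifold J' ∞ M'] [J'.Boundaryless]

theorem smoothAt_sumForms {ι ι' : Type*} {θ : ι → OneForm J M} {θ' : ι' → OneForm J' M'}
    {p : M × M'} (h : ∀ i, (θ i).SmoothAt p.1) (h' : ∀ i, (θ' i).SmoothAt p.2) (i : ι ⊕ ι') :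
    (sumForms θ θ' i).SmoothAt p := by
  rcases i with i | i
  · exact (h i).pullForm contMDiffAt_fst
  · exact (h' i).pullForm contMDiffAt_snd

theorem d_pullForm_fst {θ : OneForm J M} {p : M × M'} (h : θ.SmoothAt p.1)
    (v w : TangentSpace (J.prod J') p) :
    (pullForm (J := J.prod J') Prod.fst θ).d p v w =
      θ.d p.1 (Prod.fst (α := E) (β := E') v) (Prod.fst (α := E) (β := E') w) := by
  rw [OneForm.d_pullForm h contMDiffAt_fst, mfderiv_fst]
  rfl

theorem d_pullForm_snd {θ : OneForm J' M'} {p : M × M'} (h : θ.SmoothAt p.2)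
    (v w : TangentSpace (J.prod J') p) :
    (pullForm (J := J.prod J') Prod.snd θ).d p v w =
      θ.d p.2 (Prod.snd (α := E) (β := E') v) (Prod.snd (α := E) (β := E') w) := by
  rw [OneForm.d_pullForm h contMDiffAt_snd, mfderiv_snd]
  rfl

end SumSystems

/-! ### Comparing a system with its reduction by a transverse submersion -/

section Reduction

variable {E H M E' H' M' : Type*}
  [NormedAddCommGroup E] [NormedSpace ℝ E] [TopologicalSpace H]
  [TopologicalSpace M] [ChartedSpace H M]
  [NormedAddCommGroup E'] [NormedSpace ℝ E'] [TopologicalSpace H']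
  [TopologicalSpace M'] [ChartedSpace H' M']
  {J : ModelWithCorners ℝ E H} {J' : ModelWithCorners ℝ E' H'}
  [IsManifold J ∞ M] [J.Boundaryless] [IsManifold J' ∞ M'] [J'.Boundaryless]
  [FiniteDimensional ℝ E] [FiniteDimensional ℝ E']

/-- Let the hyperbolic system `I` be the reduction by a transverse submersion `q` of a system `K` of
codimension four with local frame `θ`. Then `q_*` identifies the annihilators of the systems, and
the 2-forms `η 0 ∧ η 1` and `η 2 ∧ η 3` of `I` pull back to combinations of the `dθ i`. -/
theorem exists_structure_forms_of_reduction {s : ℕ} {I V W : CotangentFamily J' M'}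
    (hI : IsHyperbolic s I V W) {q : M → M'} (hq : ContMDiff J J' ∞ q)
    {K : CotangentFamily J M} (htr : IsTransverse J' q K)
    (hred : ∀ y ∈ range q, I y = reduction q K y) {p : M}
    {ι : Type*} [Fintype ι] {θ : ι → OneForm J M} (hθ : ∀ i, (θ i).SmoothAt p)
    (hli : LinearIndependent ℝ fun i ↦ θ i p)
    (hspan : ∀ᶠ y in 𝓝 p, K y = Submodule.span ℝ (range fun i ↦ θ i y))
    (hdim : Module.finrank ℝ E = Fintype.card ι + 4) :
    ∃ (b : Fin 4 → Cotangent J' (q p)) (c d : ι → ℝ),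
      (∀ v w, (∀ i, θ i p v = 0) → (∀ i, θ i p w = 0) →
        wedge (b 0) (b 1) (mfderiv J J' q p v) (mfderiv J J' q p w) =
          ∑ i, c i * (θ i).d p v w) ∧
      (∀ v w, (∀ i, θ i p v = 0) → (∀ i, θ i p w = 0) →
        wedge (b 2) (b 3) (mfderiv J J' q p v) (mfderiv J J' q p w) =
          ∑ i, d i * (θ i).d p v w) ∧
      (∃ e : Fin 4 → TangentSpace J p, (∀ l i, θ i p (e l) = 0) ∧
        ∀ k l, b k (mfderiv J J' q p (e l)) = if k = l then 1 else 0) ∧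
      (∀ v, (∀ i, θ i p v = 0) → b 0 (mfderiv J J' q p v) = 0 → b 1 (mfderiv J J' q p v) = 0 →
        mfderiv J J' q p v ∈ ann (V (q p))) ∧
      (∀ v, (∀ i, θ i p v = 0) → b 2 (mfderiv J J' q p v) = 0 → b 3 (mfderiv J J' q p v) = 0 →
        mfderiv J J' q p v ∈ ann (W (q p))) := by
  obtain ⟨hs, hI⟩ := hI
  obtain ⟨U, hU, hpU, Θ, η, hΘs, -, hU'⟩ := hI (q p)
  obtain ⟨-, hsp, hIq, hV, hW, -, hd1, hd2⟩ := hU' _ hpU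
  have hann : ∀ v, (∀ i, θ i p v = 0) → v ∈ ann (K p) := fun v hv ↦ by
    rw [hspan.self_of_nhds]
    exact mem_ann_span_range.2 hv
  have hmem : ∀ i, ∀ y, q y ∈ U → pullForm (J := J) q (Θ i) y ∈ K y := by
    intro i y hy
    have h1 : Θ i (q y) ∈ I (q y) := by
      rw [(hU' _ hy).2.2.1]
      exact Submodule.subset_span ⟨i, rfl⟩
    rw [hred _ ⟨y, rfl⟩] at h1
    exact h1 y rfl
  have hQ : ∀ v, (∀ i, θ i p v = 0) → ∀ i, Θ i (q p) (mfderiv J J' q p v) = 0 :=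
    fun v hv i ↦ hann v hv _ (hmem i p hpU)
  have hQI : ∀ v, (∀ i, θ i p v = 0) → mfderiv J J' q p v ∈ ann (I (q p)) := fun v hv ↦ by
    rw [hIq]
    exact mem_ann_span_range.2 (hQ v hv)
  have hΘ : ∀ i, (Θ i).SmoothAt (q p) := fun i ↦ (OneForm.smoothOn_iff hU).1 (hΘs i) _ hpU
  -- The pullback of `Θ i` is a section of `K` near `p`, so its derivative is a combination of the
  -- `dθ i` modulo `K`.
  have hsum : ∀ i, ∃ c : ι → ℝ, ∀ v w, (∀ i, θ i p v = 0) → (∀ i, θ i p w = 0) →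
      (Θ i).d (q p) (mfderiv J J' q p v) (mfderiv J J' q p w) = ∑ i, c i * (θ i).d p v w := by
    intro i
    obtain ⟨c, hc⟩ := exists_d_eq_sum hθ hli ((hΘ i).pullForm hq.contMDiffAt) (by
      filter_upwards [hspan, hq.continuous.continuousAt.preimage_mem_nhds (hU.mem_nhds hpU)]
        with y h1 h2
      rw [← h1]
      exact hmem i y h2)
    refine ⟨c, fun v w hv hw ↦ ?_⟩
    rw [← hc v w hv hw, OneForm.d_pullForm (hΘ i) hq.contMDiffAt]
  -- The positions `s - 2` and `s - 1` carry the two non-trivial structure equations of `I`.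
  obtain ⟨c, hc⟩ := hsum ⟨s - 2, by omega⟩
  obtain ⟨d, hd⟩ := hsum ⟨s - 1, by omega⟩
  refine ⟨fun k ↦ η k (q p), c, d, fun v w hv hw ↦ ?_, fun v w hv hw ↦ ?_, ?_, ?_, ?_⟩
  · rw [← hc v w hv hw]
    exact (hd1 ⟨s - 2, by omega⟩ (by simp only; omega) _ (hQI v hv) _ (hQI w hw)).symm
  · rw [← hd v w hv hw]
    exact (hd2 ⟨s - 1, by omega⟩ (by simp only; omega) _ (hQI v hv) _ (hQI w hw)).symm
  -- Transversality makes `q_*` injective on `ann K`. Equality of ranks then lifts the basis of `ann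
  -- I` dual to `η` to vectors `e` in `ann K`.
  · have key := exists_apply_eq_of_injOn (E := E) (E' := E') (ι := ι) (m := 4) hli hdim hsp
      (mfderiv J J' q p) hQ (fun v hv h0 ↦ htr p v h0 (hann v hv))
    choose e he he' using fun l : Fin 4 ↦ key fun k ↦ if k = l then 1 else 0
    exact ⟨e, he, fun k l ↦ he' l k⟩
  · intro v hv h0 h1
    rw [hV]
    intro α hα
    refine clm_apply_eq_zero_of_mem_span (E := E') hα ?_
    rintro _ (⟨i, rfl⟩ | rfl | rfl)
    exacts [hQ v hv i, h0, h1]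
  · intro v hv h0 h1
    rw [hW]
    intro α hα
    refine clm_apply_eq_zero_of_mem_span (E := E') hα ?_
    rintro _ (⟨i, rfl⟩ | rfl | rfl)
    exacts [hQ v hv i, h0, h1]

/-- In the situation of `exists_structure_forms_of_reduction`, the 2-forms `dθ i` are not all
multiples of a single one modulo `K`. -/
theorem not_d_eq_mul_of_reduction {s : ℕ} {I V W : CotangentFamily J' M'}
    (hI : IsHyperbolic s I V W) {q : M → M'} (hq : ContMDiff J J' ∞ q)
    {K : CotangentFamily J M} (htr : IsTransverse J' q K)
    (hred : ∀ y ∈ range q, I y = reduction q K y) {p : M}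
    {ι : Type*} [Fintype ι] {θ : ι → OneForm J M} (hθ : ∀ i, (θ i).SmoothAt p)
    (hli : LinearIndependent ℝ fun i ↦ θ i p)
    (hspan : ∀ᶠ y in 𝓝 p, K y = Submodule.span ℝ (range fun i ↦ θ i y))
    (hdim : Module.finrank ℝ E = Fintype.card ι + 4)
    {Φ : TangentSpace J p → TangentSpace J p → ℝ} {a : ι → ℝ}
    (h : ∀ i v w, (∀ i, θ i p v = 0) → (∀ i, θ i p w = 0) → (θ i).d p v w = a i * Φ v w) :
    False := by
  obtain ⟨b, c, d, hc, hd, ⟨e, he, hbe⟩, -, -⟩ :=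
    exists_structure_forms_of_reduction hI hq htr hred hθ hli hspan hdim
  have mul : ∀ (c : ι → ℝ) l l', ∑ i, c i * (θ i).d p (e l) (e l') =
      (∑ i, c i * a i) * Φ (e l) (e l') := by
    intro c l l'
    rw [Finset.sum_mul]
    exact Finset.sum_congr rfl fun i _ ↦ by rw [h i _ _ (he l) (he l'), mul_assoc]
  -- On `(e 0, e 1)` the two forms of `I` take the values 1 and 0, and on `(e 2, e 3)` the second is
  -- 1. If both were multiples of `Φ`, the value 0 would force `Φ (e 0) (e 1) = 0` or a zero second
  -- multiplier, and each contradicts a value 1.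
  have h1 := hc _ _ (he 0) (he 1)
  have h2 := hd _ _ (he 0) (he 1)
  have h3 := hd _ _ (he 2) (he 3)
  simp only [wedge, hbe, mul, Fin.reduceEq, if_true, if_false] at h1 h2 h3
  norm_num at h1 h2 h3
  rcases h2 with h2 | h2
  · rw [h2] at h3; norm_num at h3
  · rw [h2] at h1; norm_num at h1

/-- A vector which is characteristic for `K` projects to one which is characteristic for the
reduction `I`. -/
theorem mem_ann_of_reduction {s s' : ℕ} {I V W : CotangentFamily J' M'}
    (hI : IsHyperbolic s I V W) {q : M → M'} (hq : ContMDiff J J' ∞ q)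
    {K A B : CotangentFamily J M} (htr : IsTransverse J' q K)
    (hred : ∀ y ∈ range q, I y = reduction q K y) (hK : IsHyperbolic s' K A B)
    {p : M} {v : TangentSpace J p} (hv : v ∈ ann (A p) ∨ v ∈ ann (B p)) :
    mfderiv J J' q p v ∈ ann (V (q p)) ∨ mfderiv J J' q p v ∈ ann (W (q p)) := by
  obtain ⟨hs', hK⟩ := hK
  obtain ⟨U, hU, hpU, θ, η, hθs, -, hU'⟩ := hK p
  obtain ⟨hcof, hsp, hKp, hA, hB, hd0, hd1, hd2⟩ := hU' _ hpU
  have hdim : Module.finrank ℝ E = Fintype.card (Fin s') + 4 := by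
    rw [finrank_eq_card_of_coframe (E := E) hcof hsp, Fintype.card_sum, Fintype.card_fin 4]
  obtain ⟨b, c, d, hc, hd, ⟨e, he, hbe⟩, hbV, hbW⟩ :=
    exists_structure_forms_of_reduction hI hq htr hred
      (fun i ↦ (OneForm.smoothOn_iff hU).1 (hθs i) _ hpU) (hcof.comp Sum.inl Sum.inl_injective)
      (by filter_upwards [hU.mem_nhds hpU] with y hy using (hU' y hy).2.2.1) hdim
  have hann : ∀ v, (∀ i, θ i p v = 0) → v ∈ ann (K p) := fun v hv ↦ by
    rw [hKp]
    exact mem_ann_span_range.2 hv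
  -- Only the last two structure forms of `K` survive in such a sum.
  have hsum : ∀ (c : Fin s' → ℝ), ∃ x y, ∀ v w, (∀ i, θ i p v = 0) → (∀ i, θ i p w = 0) →
      ∑ i, c i * (θ i).d p v w = x * wedge (η 0 p) (η 1 p) v w + y * wedge (η 2 p) (η 3 p) v w := by
    intro c
    let i₁ : Fin s' := ⟨s' - 2, by omega⟩
    let i₂ : Fin s' := ⟨s' - 1, by omega⟩
    refine ⟨c i₁, c i₂, fun v w hv hw ↦ ?_⟩
    have hne : i₁ ≠ i₂ := by simp only [i₁, i₂, ne_eq, Fin.mk.injEq]; omega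
    rw [← hd1 i₁ (by simp only [i₁]; omega) v (hann v hv) w (hann w hw),
      ← hd2 i₂ (by simp only [i₂]; omega) v (hann v hv) w (hann w hw)]
    refine Finset.sum_eq_add i₁ i₂ hne (fun i _ hi ↦ ?_) (by simp) (by simp)
    have hi' : (i : ℕ) + 2 < s' := by
      have h1 : (i : ℕ) ≠ s' - 2 := fun h ↦ hi.1 (Fin.ext h)
      have h2 : (i : ℕ) ≠ s' - 1 := fun h ↦ hi.2 (Fin.ext h)
      omega
    rw [hd0 i hi' v (hann v hv) w (hann w hw)]
    exact mul_zero _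
  obtain ⟨x, y, hxy⟩ := hsum c
  obtain ⟨z, t, hzt⟩ := hsum d
  have hvK : ∀ i, θ i p v = 0 := by
    intro i
    rcases hv with hv | hv
    · exact hv _ (by rw [hA]; exact Submodule.subset_span (.inl ⟨i, rfl⟩))
    · exact hv _ (by rw [hB]; exact Submodule.subset_span (.inl ⟨i, rfl⟩))
  have e1 : ∀ l l', wedge (b 0) (b 1) (mfderiv J J' q p (e l)) (mfderiv J J' q p (e l')) =
      x * wedge (η 0 p) (η 1 p) (e l) (e l') + y * wedge (η 2 p) (η 3 p) (e l) (e l') :=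
    fun l l' ↦ (hc _ _ (he l) (he l')).trans (hxy _ _ (he l) (he l'))
  have e2 : ∀ l l', wedge (b 2) (b 3) (mfderiv J J' q p (e l)) (mfderiv J J' q p (e l')) =
      z * wedge (η 0 p) (η 1 p) (e l) (e l') + t * wedge (η 2 p) (η 3 p) (e l) (e l') :=
    fun l l' ↦ (hd _ _ (he l) (he l')).trans (hzt _ _ (he l) (he l'))
  have f1 : ∀ l, wedge (b 0) (b 1) (mfderiv J J' q p v) (mfderiv J J' q p (e l)) =
      x * wedge (η 0 p) (η 1 p) v (e l) + y * wedge (η 2 p) (η 3 p) v (e l) :=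
    fun l ↦ (hc _ _ hvK (he l)).trans (hxy _ _ hvK (he l))
  have f2 : ∀ l, wedge (b 2) (b 3) (mfderiv J J' q p v) (mfderiv J J' q p (e l)) =
      z * wedge (η 0 p) (η 1 p) v (e l) + t * wedge (η 2 p) (η 3 p) v (e l) :=
    fun l ↦ (hd _ _ hvK (he l)).trans (hzt _ _ hvK (he l))
  -- some non-trivial combination of the two pulled back 2-forms is annihilated by `v`
  obtain ⟨m, n, hmn, hcomb⟩ : ∃ m n : ℝ, (m ≠ 0 ∨ n ≠ 0) ∧ ∀ l,
      m * wedge (b 0) (b 1) (mfderiv J J' q p v) (mfderiv J J' q p (e l)) +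
      n * wedge (b 2) (b 3) (mfderiv J J' q p v) (mfderiv J J' q p (e l)) = 0 := by
    have g1 := e1 0 1
    have g2 := e2 0 1
    have g3 := e1 2 3
    have g4 := e2 2 3
    simp only [wedge, hbe, Fin.reduceEq, if_true, if_false] at g1 g2 g3 g4
    norm_num at g1 g2 g3 g4
    -- If the determinant vanished, the values 1 and 0 of the two pulled back forms on `(e 0, e 1)`
    -- would force, by Cramer's rule, the second row `(z, t)` to be zero, although the second form
    -- is 1 on `(e 2, e 3)`.
    have hdet : x * t - y * z ≠ 0 := by
      intro h0
      have k1 : t = 0 := by linear_combination t * g1 - y * g2 +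
        (η 0 p (e 0) * η 1 p (e 1) - η 0 p (e 1) * η 1 p (e 0)) * h0
      have k2 : z = 0 := by linear_combination z * g1 - x * g2 -
        (η 2 p (e 0) * η 3 p (e 1) - η 2 p (e 1) * η 3 p (e 0)) * h0
      rw [k1, k2] at g4
      norm_num at g4
    rcases hv with hv | hv
    · have z0 : η 0 p v = 0 := hv _ (by rw [hA]; exact Submodule.subset_span (.inr (.inl rfl)))
      have z1 : η 1 p v = 0 := hv _ (by rw [hA]; exact Submodule.subset_span (.inr (.inr rfl)))
      -- Contraction with `v` kills `η 0 ∧ η 1`, and these coefficients eliminate `η 2 ∧ η 3`. They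
      -- are not both zero because the determinant is non-zero.
      refine ⟨t, -y, ?_, fun l ↦ ?_⟩
      · by_contra! h0
        exact hdet (by rw [h0.1, neg_eq_zero.1 h0.2]; ring)
      · rw [f1, f2]
        simp only [wedge, z0, z1]
        ring
    · have z2 : η 2 p v = 0 := hv _ (by rw [hB]; exact Submodule.subset_span (.inr (.inl rfl)))
      have z3 : η 3 p v = 0 := hv _ (by rw [hB]; exact Submodule.subset_span (.inr (.inr rfl)))
      refine ⟨z, -x, ?_, fun l ↦ ?_⟩
      · by_contra! h0
        exact hdet (by rw [h0.1, neg_eq_zero.1 h0.2]; ring)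
      · rw [f1, f2]
        simp only [wedge, z2, z3]
        ring
  -- Pairing with the dual vectors `e l` isolates the products of `m` with `b 0`, `b 1`, and of `n`
  -- with `b 2`, `b 3`, on the projected vector.
  have c0 := hcomb 0
  have c1 := hcomb 1
  have c2 := hcomb 2
  have c3 := hcomb 3
  simp only [wedge, hbe, Fin.reduceEq, if_true, if_false] at c0 c1 c2 c3
  norm_num at c0 c1 c2 c3
  rcases hmn with hm | hn
  · exact .inl (hbV v hvK (c1.resolve_left hm) (c0.resolve_left hm))
  · exact .inr (hbW v hvK (c3.resolve_left hn) (c2.resolve_left hn))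

end Reduction

/-! ### Normal forms of the two factors and hyperbolicity of their sum -/

section Hyperbolic

variable {E H M E' H' M' : Type*}
  [NormedAddCommGroup E] [NormedSpace ℝ E] [TopologicalSpace H]
  [TopologicalSpace M] [ChartedSpace H M]
  [NormedAddCommGroup E'] [NormedSpace ℝ E'] [TopologicalSpace H']
  [TopologicalSpace M'] [ChartedSpace H' M']
  {J : ModelWithCorners ℝ E H} {J' : ModelWithCorners ℝ E' H'}

/-- Two transpositions correct `f` at `a` and then at `b`. This serves to reorder a frame, since
`IsHyperbolic` prescribes the positions of the two special forms. -/
theorem exists_equiv_apply_eq {α β : Type*} [DecidableEq β] (f : α ≃ β) {a b : α} (hab : a ≠ b)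
    {x y : β} (hxy : x ≠ y) : ∃ e : α ≃ β, e a = x ∧ e b = y := by
  let g := f.trans (Equiv.swap (f a) x)
  have ga : g a = x := Equiv.swap_apply_left _ _
  have gb : x ≠ g b := fun h ↦ hab (g.injective (ga.trans h))
  exact ⟨g.trans (Equiv.swap (g b) y), by
    rw [Equiv.trans_apply, ga, Equiv.swap_apply_of_ne_of_ne gb hxy],
    Equiv.swap_apply_left _ _⟩

/-- `θ` and `η` form a coframe about `x` in which the only structure equation of
`K = span {θ i}`, modulo `K`, is `dθ j ≡ η 0 ∧ η 1`. -/
def HasNormalFormAt (r : ℕ) (K : CotangentFamily J M) (x : M) : Prop :=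
  ∃ U : Set M, IsOpen U ∧ x ∈ U ∧ ∃ (j : Fin r) (θ : Fin r → OneForm J M) (η : Fin 2 → OneForm J M),
    ∀ y ∈ U, (∀ i, (θ i).SmoothAt y) ∧ (∀ k, (η k).SmoothAt y) ∧
      Submodule.span ℝ (range (Sum.elim (fun i ↦ θ i y) (fun k ↦ η k y))) = ⊤ ∧
      K y = Submodule.span ℝ (range fun i ↦ θ i y) ∧
      (∀ i ≠ j, CongrMod K y ((θ i).d y) 0) ∧
      CongrMod K y ((θ j).d y) (wedge (η 0 y) (η 1 y))

variable [IsManifold J ∞ M] [J.Boundaryless] [IsManifold J' ∞ M'] [J'.Boundaryless]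
  [FiniteDimensional ℝ E] [FiniteDimensional ℝ E']

/-- The structure equations of the factors decouple on the product, each contributing one
decomposable form. Completing one summand to the full cotangent space of its factor gives the
singular systems. -/
theorem isHyperbolic_sumSystem {r r' : ℕ} {K : CotangentFamily J M} {K' : CotangentFamily J' M'}
    (hdim : Module.finrank ℝ E = r + 2) (hdim' : Module.finrank ℝ E' = r' + 2) (h2 : 2 ≤ r + r')
    (h : ∀ p : M × M', HasNormalFormAt r K p.1 ∧ HasNormalFormAt r' K' p.2) :
    IsHyperbolic (J := J.prod J') (r + r') (sumSystem K K') (sumSystem (fun _ ↦ ⊤) K')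
      (sumSystem K fun _ ↦ ⊤) := by
  classical
  refine ⟨h2, fun p ↦ ?_⟩
  obtain ⟨⟨U, hU, hpU, j, θ, η, hθ⟩, ⟨U', hU', hpU', j', θ', η', hθ'⟩⟩ := h p
  -- The exceptional forms `j` and `j'` of the factors are moved to the last two places.
  obtain ⟨e, ha, hb⟩ := exists_equiv_apply_eq (finSumFinEquiv (m := r) (n := r')).symm
    (a := ⟨r + r' - 2, by omega⟩) (b := ⟨r + r' - 1, by omega⟩)
    (by rw [ne_eq, Fin.mk.injEq]; omega) (Sum.inl_ne_inr (a := j) (b := j'))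
  let F := sumForms θ θ'
  let Z : Fin 4 → OneForm (J.prod J') (M × M') :=
    ![pullForm Prod.fst (η 0), pullForm Prod.fst (η 1), pullForm Prod.snd (η' 0),
      pullForm Prod.snd (η' 1)]
  have hUU : IsOpen (U ×ˢ U') := hU.prod hU'
  refine ⟨U ×ˢ U', hUU, ⟨hpU, hpU'⟩, fun i ↦ F (e i), Z, fun i ↦ ?_, fun k ↦ ?_, fun y hy ↦ ?_⟩
  · exact (OneForm.smoothOn_iff hUU).2 fun y hy ↦
      smoothAt_sumForms (hθ _ hy.1).1 (hθ' _ hy.2).1 (e i)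
  · refine (OneForm.smoothOn_iff hUU).2 fun y hy ↦ ?_
    have h1 := fun k ↦ ((hθ _ hy.1).2.1 k).pullForm (J := J.prod J') (x := y) contMDiffAt_fst
    have h2 := fun k ↦ ((hθ' _ hy.2).2.1 k).pullForm (J := J.prod J') (x := y) contMDiffAt_snd
    fin_cases k
    exacts [h1 0, h1 1, h2 0, h2 1]
  obtain ⟨hs, -, hsp, hK, hd0, hdj⟩ := hθ _ hy.1
  obtain ⟨hs', -, hsp', hK', hd0', hdj'⟩ := hθ' _ hy.2
  have hF : (range fun i ↦ F (e i) y) = range fun i ↦ F i y :=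
    e.surjective.range_comp fun i ↦ F i y
  -- submodules containing the pulled back frames
  have le_fst : ∀ S : Submodule ℝ (Cotangent (J.prod J') y), (∀ i, F (.inl i) y ∈ S) →
      Z 0 y ∈ S → Z 1 y ∈ S →
      (⊤ : Submodule ℝ (Cotangent J y.1)).map (pullback (J.prod J') J Prod.fst y) ≤ S := by
    intro S h1 h2 h3
    rw [← hsp, Submodule.map_span, Submodule.span_le]
    rintro _ ⟨_, ⟨i | k, rfl⟩, rfl⟩
    · exact h1 i
    · fin_cases k
      exacts [h2, h3]
  have le_snd : ∀ S : Submodule ℝ (Cotangent (J.prod J') y), (∀ i, F (.inr i) y ∈ S) →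
      Z 2 y ∈ S → Z 3 y ∈ S →
      (⊤ : Submodule ℝ (Cotangent J' y.2)).map (pullback (J.prod J') J' Prod.snd y) ≤ S := by
    intro S h1 h2 h3
    rw [← hsp', Submodule.map_span, Submodule.span_le]
    rintro _ ⟨_, ⟨i | k, rfl⟩, rfl⟩
    · exact h1 i
    · fin_cases k
      exacts [h2, h3]
  have hspan := span_sumForms hK hK'
  have htop : Submodule.span ℝ (range (Sum.elim (fun i ↦ F (e i) y) (fun k ↦ Z k y))) = ⊤ := by
    rw [eq_top_iff, ← sumSystem_top y]
    have hmF : ∀ i, F i y ∈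
        Submodule.span ℝ (range (Sum.elim (fun i ↦ F (e i) y) (fun k ↦ Z k y))) := fun i ↦
      Submodule.subset_span ⟨.inl (e.symm i), by simp⟩
    have hmZ : ∀ k, Z k y ∈
        Submodule.span ℝ (range (Sum.elim (fun i ↦ F (e i) y) (fun k ↦ Z k y))) := fun k ↦
      Submodule.subset_span ⟨.inr k, rfl⟩
    exact sup_le (le_fst _ (fun i ↦ hmF _) (hmZ 0) (hmZ 1))
      (le_snd _ (fun i ↦ hmF _) (hmZ 2) (hmZ 3))
  have hfst : ∀ v ∈ ann (sumSystem K K' y), Prod.fst (α := E) (β := E') v ∈ ann (K y.1) :=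
    fun v hv α hα ↦ (pullback_fst_apply α v).symm.trans
      (hv _ (Submodule.mem_sup_left (Submodule.mem_map_of_mem hα)))
  have hsnd : ∀ v ∈ ann (sumSystem K K' y), Prod.snd (α := E) (β := E') v ∈ ann (K' y.2) :=
    fun v hv α hα ↦ (pullback_snd_apply α v).symm.trans
      (hv _ (Submodule.mem_sup_right (Submodule.mem_map_of_mem hα)))
  refine ⟨?_, htop, by rw [hspan, hF], ?_, ?_, ?_, ?_, ?_⟩
  -- A spanning family of `(r + r') + 4` covectors, which is the dimension of the product, is
  -- independent.
  · refine linearIndependent_of_top_le_span_of_card_eq_finrank htop.ge ?_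
    refine Eq.trans ?_ (finrank_clm_dual (E := E × E')).symm
    rw [Module.finrank_prod, hdim, hdim']
    simp only [Fintype.card_sum, Fintype.card_fin]
    omega
  · rw [hF]
    have hm : ∀ i, F i y ∈ Submodule.span ℝ ((range fun i ↦ F i y) ∪ {Z 0 y, Z 1 y}) := fun i ↦
      Submodule.subset_span (.inl ⟨i, rfl⟩)
    refine le_antisymm (sup_le (le_fst _ (fun i ↦ hm _) (Submodule.subset_span (.inr (.inl rfl)))
      (Submodule.subset_span (.inr (.inr rfl)))) ?_) (Submodule.span_le.2 ?_)
    · rw [hK', Submodule.map_span, Submodule.span_le]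
      rintro _ ⟨_, ⟨i, rfl⟩, rfl⟩
      exact hm (.inr i)
    · rintro _ (⟨i | i, rfl⟩ | rfl | rfl)
      · exact Submodule.mem_sup_left (Submodule.mem_map_of_mem Submodule.mem_top)
      · refine Submodule.mem_sup_right (Submodule.mem_map_of_mem ?_)
        rw [hK']
        exact Submodule.subset_span ⟨i, rfl⟩
      · exact Submodule.mem_sup_left (Submodule.mem_map_of_mem Submodule.mem_top)
      · exact Submodule.mem_sup_left (Submodule.mem_map_of_mem Submodule.mem_top)
  · rw [hF]
    have hm : ∀ i, F i y ∈ Submodule.span ℝ ((range fun i ↦ F i y) ∪ {Z 2 y, Z 3 y}) := fun i ↦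
      Submodule.subset_span (.inl ⟨i, rfl⟩)
    refine le_antisymm (sup_le ?_ (le_snd _ (fun i ↦ hm _) (Submodule.subset_span (.inr (.inl rfl)))
      (Submodule.subset_span (.inr (.inr rfl))))) (Submodule.span_le.2 ?_)
    · rw [hK, Submodule.map_span, Submodule.span_le]
      rintro _ ⟨_, ⟨i, rfl⟩, rfl⟩
      exact hm (.inl i)
    · rintro _ (⟨i | i, rfl⟩ | rfl | rfl)
      · refine Submodule.mem_sup_left (Submodule.mem_map_of_mem ?_)
        rw [hK]
        exact Submodule.subset_span ⟨i, rfl⟩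
      · exact Submodule.mem_sup_right (Submodule.mem_map_of_mem Submodule.mem_top)
      · exact Submodule.mem_sup_right (Submodule.mem_map_of_mem Submodule.mem_top)
      · exact Submodule.mem_sup_right (Submodule.mem_map_of_mem Submodule.mem_top)
  · intro i hi v hv w hw
    have h1 : e i ≠ .inl j := fun h ↦ by
      have := e.injective (h.trans ha.symm)
      rw [Fin.ext_iff] at this
      simp only at this
      omega
    have h2 : e i ≠ .inr j' := fun h ↦ by
      have := e.injective (h.trans hb.symm)
      rw [Fin.ext_iff] at this
      simp only at this
      omega
    change (F (e i)).d y v w = 0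
    rcases hei : e i with k | k
    · rw [hei] at h1
      exact (d_pullForm_fst (hs k) v w).trans
        (hd0 k (fun hk ↦ h1 (by rw [hk])) _ (hfst v hv) _ (hfst w hw))
    · rw [hei] at h2
      exact (d_pullForm_snd (hs' k) v w).trans
        (hd0' k (fun hk ↦ h2 (by rw [hk])) _ (hsnd v hv) _ (hsnd w hw))
  · intro i hi v hv w hw
    have h1 : e i = .inl j := by
      rw [← ha]
      exact congrArg e (Fin.ext (by simp only; omega))
    change (F (e i)).d y v w = _
    rw [h1]
    refine ((d_pullForm_fst (hs j) v w).trans (hdj _ (hfst v hv) _ (hfst w hw))).trans ?_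
    have hz : ∀ k x, pullForm (J := J.prod J') Prod.fst (η k) y x =
      η k y.1 (Prod.fst (α := E) (β := E') x) := fun k x ↦ pullback_fst_apply _ x
    exact (congrArg₂ (· - ·) (congrArg₂ (· * ·) (hz 0 v) (hz 1 w))
      (congrArg₂ (· * ·) (hz 0 w) (hz 1 v))).symm
  · intro i hi v hv w hw
    have h1 : e i = .inr j' := by
      rw [← hb]
      exact congrArg e (Fin.ext (by simp only; omega))
    change (F (e i)).d y v w = _
    rw [h1]
    refine ((d_pullForm_snd (hs' j') v w).trans (hdj' _ (hsnd v hv) _ (hsnd w hw))).trans ?_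
    have hz : ∀ k x, pullForm (J := J.prod J') Prod.snd (η' k) y x =
      η' k y.2 (Prod.snd (α := E) (β := E') x) := fun k x ↦ pullback_snd_apply _ x
    exact (congrArg₂ (· - ·) (congrArg₂ (· * ·) (hz 0 v) (hz 1 w))
      (congrArg₂ (· * ·) (hz 0 w) (hz 1 v))).symm

/-- A Pfaffian system of codimension two has a normal form about each point at which some structure
2-form is non-zero. -/
theorem hasNormalFormAt_of_not_integrable {r : ℕ} {K : CotangentFamily J M}
    (hdim : Module.finrank ℝ E = r + 2) {U : Set M} (hU : IsOpen U) {x : M} (hx : x ∈ U)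
    {θ : Fin r → OneForm J M} (hθ : ∀ i, ∀ y ∈ U, (θ i).SmoothAt y)
    (hli : LinearIndependent ℝ (fun i ↦ θ i x))
    (hK : ∀ y ∈ U, K y = Submodule.span ℝ (range fun i ↦ θ i y))
    (h : ¬ ∀ i v w, (∀ i, θ i x v = 0) → (∀ i, θ i x w = 0) → (θ i).d x v w = 0) :
    HasNormalFormAt r K x := by
  push Not at h
  obtain ⟨j, v, w, hv, hw, hj⟩ := h
  obtain ⟨U', hU'U, hU', hxU', θ', η, hform⟩ :=
    exists_local_normal_form hU hx hθ hli hdim hv hw hj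
  refine ⟨U', hU', hxU', j, θ', η, fun y hy ↦ ?_⟩
  obtain ⟨h1, h2, h3, h4, h5⟩ := hform y hy
  have hann : ∀ v ∈ ann (K y), ∀ i, θ i y v = 0 := fun v hv ↦ by
    rw [hK y (hU'U hy)] at hv
    exact mem_ann_span_range.1 hv
  refine ⟨h1, h2, h3, by rw [h4, hK y (hU'U hy)], fun i hi v hv w hw ↦ ?_, fun v hv w hw ↦ ?_⟩
  · exact (h5 v w (hann v hv) (hann w hw)).1 i hi
  · exact (h5 v w (hann v hv) (hann w hw)).2

/-- If a hyperbolic system is the reduction of a sum of two systems of codimension two, then both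
of these have a normal form about each point. -/
theorem hasNormalFormAt_of_reduction {E'' H'' M'' : Type*}
    [NormedAddCommGroup E''] [NormedSpace ℝ E''] [FiniteDimensional ℝ E''] [TopologicalSpace H'']
    [TopologicalSpace M''] [ChartedSpace H'' M''] {J'' : ModelWithCorners ℝ E'' H''}
    [IsManifold J'' ∞ M''] [J''.Boundaryless] {r r' s : ℕ} {I V W : CotangentFamily J'' M''}
    (hI : IsHyperbolic s I V W) {K : CotangentFamily J M} {K' : CotangentFamily J' M'}
    (hK : IsPfaffianSystem r K) (hK' : IsPfaffianSystem r' K')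
    (hdim : Module.finrank ℝ E = r + 2) (hdim' : Module.finrank ℝ E' = r' + 2)
    {q : M × M' → M''} (hq : ContMDiff (J.prod J') J'' ∞ q)
    (htr : IsTransverse J'' q (sumSystem K K'))
    (hred : ∀ y ∈ range q, I y = reduction q (sumSystem K K') y) (p : M × M') :
    HasNormalFormAt r K p.1 ∧ HasNormalFormAt r' K' p.2 := by
  obtain ⟨U, hU, hpU, θ, hθ, hKU⟩ := hK p.1
  obtain ⟨U', hU', hpU', θ', hθ', hKU'⟩ := hK' p.2
  have hs := fun i ↦ (OneForm.smoothOn_iff hU).1 (hθ i)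
  have hs' := fun i ↦ (OneForm.smoothOn_iff hU').1 (hθ' i)
  have hli := (hKU _ hpU).1
  have hli' := (hKU' _ hpU').1
  have hspan : ∀ᶠ y in 𝓝 p, sumSystem K K' y =
      Submodule.span ℝ (range fun i ↦ sumForms θ θ' i y) := by
    filter_upwards [(hU.prod hU').mem_nhds ⟨hpU, hpU'⟩] with y hy
    exact span_sumForms (hKU _ hy.1).2 (hKU' _ hy.2).2
  have hdim₂ : Module.finrank ℝ (E × E') = Fintype.card (Fin r ⊕ Fin r') + 4 := by
    rw [Module.finrank_prod, hdim, hdim']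
    simp only [Fintype.card_sum, Fintype.card_fin]
    omega
  have key := fun Φ a ↦ not_d_eq_mul_of_reduction hI hq htr hred
    (fun i ↦ smoothAt_sumForms (fun i ↦ hs i _ hpU) (fun i ↦ hs' i _ hpU') i)
    (linearIndependent_sumForms hli hli') hspan hdim₂ (Φ := Φ) (a := a)
  have hfst : ∀ v : TangentSpace (J.prod J') p, (∀ i, sumForms θ θ' i p v = 0) →
      ∀ i, θ i p.1 (Prod.fst (α := E) (β := E') v) = 0 := fun v hv i ↦
    (pullback_fst_apply _ v).symm.trans (hv (.inl i))
  have hsnd : ∀ v : TangentSpace (J.prod J') p, (∀ i, sumForms θ θ' i p v = 0) →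
      ∀ i, θ' i p.2 (Prod.snd (α := E) (β := E') v) = 0 := fun v hv i ↦
    (pullback_snd_apply _ v).symm.trans (hv (.inr i))
  constructor
  -- If the structure forms of `K` vanish at `p.1`, those of the sum are all multiples of the single
  -- area form on the plane `ann K'`.
  · refine hasNormalFormAt_of_not_integrable hdim hU hpU hs hli (fun y hy ↦ (hKU y hy).2) fun h0 ↦ ?_
    obtain ⟨c, hc⟩ := exists_d_eq_mul_wedge hli' hdim'
    choose a ha using fun i ↦ hc (θ' i) (hs' i _ hpU')
    refine key (fun v w ↦ wedge (c 0) (c 1) (Prod.snd (α := E) (β := E') v)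
      (Prod.snd (α := E) (β := E') w)) (Sum.elim 0 a) ?_
    rintro (i | i) v w hv hw
    · exact ((d_pullForm_fst (hs i _ hpU) v w).trans
        (h0 i _ _ (hfst v hv) (hfst w hw))).trans (zero_mul _).symm
    · exact (d_pullForm_snd (hs' i _ hpU') v w).trans (ha i _ _ (hsnd v hv) (hsnd w hw))
  · refine hasNormalFormAt_of_not_integrable hdim' hU' hpU' hs' hli' (fun y hy ↦ (hKU' y hy).2)
      fun h0 ↦ ?_
    obtain ⟨c, hc⟩ := exists_d_eq_mul_wedge hli hdim
    choose a ha using fun i ↦ hc (θ i) (hs i _ hpU)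
    refine key (fun v w ↦ wedge (c 0) (c 1) (Prod.fst (α := E) (β := E') v)
      (Prod.fst (α := E) (β := E') w)) (Sum.elim a 0) ?_
    rintro (i | i) v w hv hw
    · exact (d_pullForm_fst (hs i _ hpU) v w).trans (ha i _ _ (hfst v hv) (hfst w hw))
    · exact ((d_pullForm_snd (hs' i _ hpU') v w).trans
        (h0 i _ _ (hsnd v hv) (hsnd w hw))).trans (zero_mul _).symm

end Hyperbolic

/-! ### Velocities of a curve and of its lift -/

/-- The points `q (σ t)` and `γ t` are only propositionally equal, so their tangent spaces are
compared through the common model space. -/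
theorem mem_ann_iff_of_eq {E H M : Type*} [NormedAddCommGroup E] [NormedSpace ℝ E]
    [TopologicalSpace H] {J : ModelWithCorners ℝ E H} [TopologicalSpace M] [ChartedSpace H M]
    (V : CotangentFamily J M) {y y' : M} (h : y = y') (v : E) :
    (show TangentSpace J y from v) ∈ ann (V y) ↔ (show TangentSpace J y' from v) ∈ ann (V y') := by
  subst h
  rfl

theorem mfderiv_velocity {E H M E' H' M' : Type*}
    [NormedAddCommGroup E] [NormedSpace ℝ E] [TopologicalSpace H]
    [TopologicalSpace M] [ChartedSpace H M]
    [NormedAddCommGroup E'] [NormedSpace ℝ E'] [TopologicalSpace H']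
    [TopologicalSpace M'] [ChartedSpace H' M']
    {J : ModelWithCorners ℝ E H} {J' : ModelWithCorners ℝ E' H'}
    {q : M → M'} (hq : ContMDiff J J' ∞ q) {σ : ℝ → M} {γ : ℝ → M'} {t : ℝ}
    (hσ : ContMDiffAt 𝓘(ℝ, ℝ) J ∞ σ t) (h : ∀ᶠ u in 𝓝 t, q (σ u) = γ u) :
    mfderiv J J' q (σ t) (velocity J σ t) = (velocity J' γ t : E') := by
  have h1 : mfderiv 𝓘(ℝ, ℝ) J' (q ∘ σ) t = _ :=
    mfderiv_comp t (hq.contMDiffAt.mdifferentiableAt (by simp)) (hσ.mdifferentiableAt (by simp))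
  have h2 := (show q ∘ σ =ᶠ[𝓝 t] γ from h).mfderiv_eq (I := 𝓘(ℝ, ℝ)) (I' := J')
  have h3 := h2.symm.trans h1
  exact (congrArg (fun A : ℝ →L[ℝ] E' ↦ A 1) h3).symm

end Pfaff

end

theorem lemma5p1
    {EG G E M E₁ M₁ E₂ M₂ F₁ Q₁ F₂ Q₂ : Type*}
    -- the Lie group
    [NormedAddCommGroup EG] [NormedSpace ℝ EG] [FiniteDimensional ℝ EG]
    [TopologicalSpace G] [ChartedSpace EG G] [Group G] [LieGroup 𝓘(ℝ, EG) ∞ G]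
    -- the manifolds
    [NormedAddCommGroup E] [NormedSpace ℝ E] [FiniteDimensional ℝ E]
    [TopologicalSpace M] [ChartedSpace E M] [IsManifold 𝓘(ℝ, E) ∞ M]
    [NormedAddCommGroup E₁] [NormedSpace ℝ E₁] [FiniteDimensional ℝ E₁]
    [TopologicalSpace M₁] [ChartedSpace E₁ M₁] [IsManifold 𝓘(ℝ, E₁) ∞ M₁]
    [NormedAddCommGroup E₂] [NormedSpace ℝ E₂] [FiniteDimensional ℝ E₂]
    [TopologicalSpace M₂] [ChartedSpace E₂ M₂] [IsManifold 𝓘(ℝ, E₂) ∞ M₂]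
    -- the orbit spaces of the actions on the two factors
    [NormedAddCommGroup F₁] [NormedSpace ℝ F₁] [FiniteDimensional ℝ F₁]
    [TopologicalSpace Q₁] [ChartedSpace F₁ Q₁] [IsManifold 𝓘(ℝ, F₁) ∞ Q₁]
    [NormedAddCommGroup F₂] [NormedSpace ℝ F₂] [FiniteDimensional ℝ F₂]
    [TopologicalSpace Q₂] [ChartedSpace F₂ Q₂] [IsManifold 𝓘(ℝ, F₂) ∞ Q₂]
    -- the Darboux integrable hyperbolic system and its singular systems
    (s : ℕ) (I V W : Pfaff.CotangentFamily 𝓘(ℝ, E) M)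
    (hI : Pfaff.IsHyperbolic s I V W) (hD : Pfaff.IsDarbouxIntegrable I V W)
    -- its canonical quotient representation
    (K₁ : Pfaff.CotangentFamily 𝓘(ℝ, E₁) M₁) (K₂ : Pfaff.CotangentFamily 𝓘(ℝ, E₂) M₂)
    (a₁ : Pfaff.LocalAction 𝓘(ℝ, EG) 𝓘(ℝ, E₁) G M₁) (a₂ : Pfaff.LocalAction 𝓘(ℝ, EG) 𝓘(ℝ, E₂) G M₂)
    (q₁ : M₁ → Q₁) (q₂ : M₂ → Q₂) (q : M₁ × M₂ → M)
    (hrep : Pfaff.IsCanonicalQuotientRep F₁ F₂ I K₁ K₂ a₁ a₂ q₁ q₂ q)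
    -- the curve and its lift, on an open interval
    (T : Set ℝ) (hT : IsOpen T) (hT' : T.OrdConnected)
    (γ : ℝ → M) (hγ : Pfaff.IsNonCharacteristicCurve I V W γ T)
    (σ : ℝ → M₁ × M₂) (hσ : Pfaff.IsIntegralCurveOf (Pfaff.sumSystem K₁ K₂) σ T)
    (hlift : ∀ t ∈ T, q (σ t) = γ t) :
    -- the sum has singular systems, and the lift is non-characteristic with respect to them
    (∃ (s' : ℕ) (A B : Pfaff.CotangentFamily (𝓘(ℝ, E₁).prod 𝓘(ℝ, E₂)) (M₁ × M₂)),
      Pfaff.IsHyperbolic s' (Pfaff.sumSystem K₁ K₂) A B) ∧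
    ∀ (s' : ℕ) (A B : Pfaff.CotangentFamily (𝓘(ℝ, E₁).prod 𝓘(ℝ, E₂)) (M₁ × M₂)),
      Pfaff.IsHyperbolic s' (Pfaff.sumSystem K₁ K₂) A B →
        Pfaff.IsNonCharacteristicCurve (Pfaff.sumSystem K₁ K₂) A B σ T := by
  obtain ⟨r₁, hK₁, hdim₁⟩ := hrep.pfaffian₁
  obtain ⟨r₂, hK₂, hdim₂⟩ := hrep.pfaffian₂
  have hq := hrep.regular_diag.contMDiff
  -- Derived systems are smaller and so have larger annihilators; transversality passes to the full
  -- sum.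
  have htr : Pfaff.IsTransverse 𝓘(ℝ, E) q (Pfaff.sumSystem K₁ K₂) := fun p v h0 hv ↦
    hrep.transverse_diag p v h0 (Pfaff.ann_anti (Pfaff.sumSystem_mono
      (Pfaff.derivedSystem_le K₁) (Pfaff.derivedSystem_le K₂) p) hv)
  have hnf := Pfaff.hasNormalFormAt_of_reduction hI hK₁ hK₂ hdim₁ hdim₂ hq htr hrep.reduction_eq
  refine ⟨?_, fun s' A B hAB ↦ ⟨hσ, fun t ht ↦ ?_⟩⟩
  · rcases isEmpty_or_nonempty (M₁ × M₂) with hempty | ⟨⟨p⟩⟩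
    -- On an empty product only the bound on the class has content, and 2 is the least class
    -- allowed.
    · exact ⟨2, fun _ ↦ ⊤, fun _ ↦ ⊤, le_rfl, fun p ↦ hempty.elim p⟩
    -- The distinguished indices show that both ranks are positive, so the class `r₁ + r₂` is at
    -- least two.
    · obtain ⟨⟨_, -, -, j₁, -⟩, ⟨_, -, -, j₂, -⟩⟩ := hnf p
      have h₁ := j₁.pos
      have h₂ := j₂.pos
      exact ⟨_, _, _, Pfaff.isHyperbolic_sumSystem hdim₁ hdim₂ (by omega) hnf⟩
  · have hvel : mfderiv (𝓘(ℝ, E₁).prod 𝓘(ℝ, E₂)) 𝓘(ℝ, E) q (σ t) (Pfaff.velocity _ σ t) =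
        (Pfaff.velocity 𝓘(ℝ, E) γ t : E) :=
      Pfaff.mfderiv_velocity hq (hσ.1.contMDiffAt (hT.mem_nhds ht))
        (Filter.mem_of_superset (hT.mem_nhds ht) hlift)
    have hchar := fun hv ↦ Pfaff.mem_ann_of_reduction hI hq htr hrep.reduction_eq hAB
      (p := σ t) (v := Pfaff.velocity _ σ t) hv
    rw [hvel] at hchar
    have hno : ¬ (Pfaff.velocity (𝓘(ℝ, E₁).prod 𝓘(ℝ, E₂)) σ t ∈ Pfaff.ann (A (σ t)) ∨
        Pfaff.velocity (𝓘(ℝ, E₁).prod 𝓘(ℝ, E₂)) σ t ∈ Pfaff.ann (B (σ t))) := fun hv ↦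
      (hchar hv).elim
        (fun h ↦ (hγ.2 t ht).1 ((Pfaff.mem_ann_iff_of_eq V (hlift t ht) _).1 h))
        (fun h ↦ (hγ.2 t ht).2 ((Pfaff.mem_ann_iff_of_eq W (hlift t ht) _).1 h))
    exact ⟨fun h ↦ hno (.inl h), fun h ↦ hno (.inr h)⟩
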